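/- **Theorem (discrete Gårding inequality).** Let $\Omega_1,\Omega_2\subset\mathbb R^3$ be disjoint, bounded, connected open sets with $\operatorname{int}\overline{\Omega_i}=\Omega_i$, let $\Gamma_I=\overline{\Omega}_1\cap\overline{\Omega}_2$ be the interface, and let $\Gamma_{io}\subset\partial(\Omega_1\cup\Omega_2)$ be a measurable part of the boundary that does not overlap $\Gamma_I$ (their intersection has surface measure zero). Denote by $n_i$ the outward unit normal of $\Omega_i$, let $n$ be a measurable field on $\Gamma_I$ that equals $n_1$ or $n_2=-n_1$ almost everywhere, let $p_i$ and $\partial p_i/\partial n$ be the traces from $\Omega_i$ of $p$ and of $n\cdot\nabla p$, and put $[\![p]\!]=n\cdot(n_1p_1+n_2p_2)$ and $\{\partial p/\partial n\}=\frac12(\partial p_1/\partial n+\partial p_2/\partial n)$ on $\Gamma_I$. Let $\mathcal T_1,\mathcal T_2$ be finite conforming tetrahedral triangulations of $\overline\Omega_1,\overline\Omega_2$ (not necessarily matching on $\Gamma_I$), with mesh size $h=\max_{K\in\mathcal T_1\cup\mathcal T_2}h_K$, where $h_K=\operatorname{diam}K$; let $\rho_K$ be the diameter of the largest ball in $K$,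 and suppose that $h_K\le\sigma\rho_K$ and $h\le\tau h_K$ for all $K\in\mathcal T_1\cup\mathcal T_2$. For $k\ge1$ let $V_h=V_1^h+V_2^h$, where $V_i^h$ is the space of complex functions that are continuous on $\Omega_i$, polynomial of degree at most $k$ on each $K\in\mathcal T_i$, and zero outside $\Omega_i$. There is a constant $C_0>0$ depending only on $k$, $\sigma$ and $\tau$ such that $C_I=C_0$ satisfies the inverse inequality $$\int_{\Gamma_I}h\,\Bigl|\Bigl\{\frac{\partial p_h}{\partial n}\Bigr\}\Bigr|^2\le C_I\int_{\Omega_1\cup\Omega_2}|\nabla p_h|^2\qquad\forall p_h\in V_h \tag{1}$$ for all such domains and meshes. Moreover, let $C_I>0$ be any constant for which (1) holds, and let $\kappa>0$, $\delta_\zeta>0$, $\gamma\ge16C_I$ and $\zeta\in L^\infty(\Gamma_I;\mathbb C)$ with $\operatorname{Re}\zeta\ge0$ a.e. on $\Gamma_I$ and $|\zeta|\ge\delta_\zeta$ a.e. on $\Gamma_I^-=\{x\in\Gamma_I:\operatorname{Im}\zeta(x)<0\}$; if $\Gamma_I^-$ has positive surface measure, suppose also that $h\le\gamma\delta_\zeta/(4\kappa)$.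 (In particular, $\zeta$ may vanish on all or part of $\Gamma_I\setminus\Gamma_I^-$.) Set $\lambda=\bigl(\frac h\gamma+\frac{\zeta}{i\kappa}\bigr)^{-1}$ and $$a_0(p,q)=\int_{\Omega_1\cup\Omega_2}\nabla p\cdot\nabla q-\kappa^2\int_{\Omega_1\cup\Omega_2}pq+i\kappa\int_{\Gamma_{io}}pq,\qquad r(p)=[\![p]\!]+\frac{\zeta}{i\kappa}\Bigl\{\frac{\partial p}{\partial n}\Bigr\},$$ $$a_\lambda(p,q)=a_0(p,q)-\int_{\Gamma_I}\Bigl\{\frac{\partial p}{\partial n}\Bigr\}r(q)-\int_{\Gamma_I}r(p)\Bigl\{\frac{\partial q}{\partial n}\Bigr\}+\int_{\Gamma_I}\frac{\zeta}{i\kappa}\Bigl\{\frac{\partial p}{\partial n}\Bigr\}\Bigl\{\frac{\partial q}{\partial n}\Bigr\}+\int_{\Gamma_I}\lambda\,r(p)\,r(q),$$ $$\|Jp\|_U^2=\kappa\int_{\Omega_1\cup\Omega_2}|p|^2+\frac1{\delta_\zeta}\int_{\Gamma_I^-}|[\![p]\!]|^2,$$ $$|||p|||^2=\int_{\Omega_1\cup\Omega_2}|\nabla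 p|^2+\kappa^2\int_{\Omega_1\cup\Omega_2}|p|^2+\frac1\gamma\int_{\Gamma_I}h\Bigl|\Bigl\{\frac{\partial p}{\partial n}\Bigr\}\Bigr|^2+\int_{\Gamma_I}|\lambda|\,|[\![p]\!]|^2 .$$ Then $$|a_\lambda(p_h,\overline{p}_h)|+2\kappa\|Jp_h\|_U^2\ \ge\ \tfrac14|||p_h|||^2\qquad\forall p_h\in V_h .$$ -/

import Mathlib

open MeasureTheory Topology

noncomputable section

/-- Euclidean three-space. -/
abbrev R3 : Type := EuclideanSpace ℝ (Fin 3)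

/-- The surface measure `dS` in three-space: two-dimensional Hausdorff measure, normalised so that
it is the area on planes. -/
abbrev surfaceMeasure : Measure R3 := Measure.euclideanHausdorffMeasure 2

/-- `ν` is the outward unit normal of `Ω` at `x`: every open cone at `x` around `-ν` smaller than
the half-space lies in `Ω` near `x`, and every such cone around `ν` lies outside `Ω` near `x`. -/
def IsOutwardNormal (Ω : Set R3) (x ν : R3) : Prop :=
  ‖ν‖ = 1 ∧ ∀ ε : ℝ, 0 < ε → ∀ᶠ y in 𝓝 x,
    (inner ℝ (y - x) ν < -(ε * ‖y - x‖) → y ∈ Ω) ∧ (ε * ‖y - x‖ < inner ℝ (y - x) ν → y ∉ Ω)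

open Classical in
/-- The outward unit normal field of `Ω` (zero where there is no outward normal; there is at most
one at each point). -/
def outwardNormal (Ω : Set R3) (x : R3) : R3 :=
  if h : ∃ ν, IsOutwardNormal Ω x ν then h.choose else 0

/-- Two disjoint bounded domains `Ω 0`, `Ω 1` in three-space (`Ω₁`, `Ω₂` on paper), neither of
which has cracks, together with a part `Γio` of the boundary which does not overlap the interface
`Γ_I = closure Ω₁ ∩ closure Ω₂`, and a choice `n` of one of the two normals on the interface. -/
structure SplitDomain where
  /-- the two subdomains -/
  Ω : Fin 2 → Set R3
  isOpen : ∀ i, IsOpen (Ω i)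
  isConnected : ∀ i, IsConnected (Ω i)
  isBounded : ∀ i, Bornology.IsBounded (Ω i)
  interior_closure : ∀ i, interior (closure (Ω i)) = Ω i
  disjoint : Disjoint (Ω 0) (Ω 1)
  /-- the part of the boundary that carries the in/outflow condition -/
  Γio : Set R3
  measurableSet_Γio : MeasurableSet Γio
  Γio_subset : Γio ⊆ frontier (Ω 0 ∪ Ω 1)
  Γio_inter : surfaceMeasure (Γio ∩ (closure (Ω 0) ∩ closure (Ω 1))) = 0
  /-- the selected normal field on the interface -/
  n : R3 → R3
  n_aestronglyMeasurable :
    AEStronglyMeasurable n (surfaceMeasure.restrict (closure (Ω 0) ∩ closure (Ω 1)))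
  n_eq : ∀ᵐ x ∂(surfaceMeasure.restrict (closure (Ω 0) ∩ closure (Ω 1))),
    n x = outwardNormal (Ω 0) x ∨ n x = outwardNormal (Ω 1) x

namespace SplitDomain

/-- The interface `Γ_I`. -/
def ΓI (D : SplitDomain) : Set R3 := closure (D.Ω 0) ∩ closure (D.Ω 1)

/-- The part `Γ_I⁻` of the interface where `Im ζ < 0`. -/
def ΓIminus (D : SplitDomain) (ζ : R3 → ℂ) : Set R3 := {x ∈ D.ΓI | (ζ x).im < 0}

/-- The trace `p_i` of `p` on the boundary of `Ω i`: the limit of `p y` as `y → x` in `Ω i`. -/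
def trace (D : SplitDomain) (i : Fin 2) (p : R3 → ℂ) (x : R3) : ℂ :=
  Filter.limUnder (𝓝[D.Ω i] x) p

/-- The trace `∂p_i/∂n` of the derivative in the direction of the normal `n`, taken from `Ω i`. -/
def normalDeriv (D : SplitDomain) (i : Fin 2) (p : R3 → ℂ) (x : R3) : ℂ :=
  Filter.limUnder (𝓝[D.Ω i] x) (fun y => fderiv ℝ p y (D.n x))

/-- The jump `⟦p⟧ = n ⬝ (n₁ p₁ + n₂ p₂)` over the interface. -/
def jump (D : SplitDomain) (p : R3 → ℂ) (x : R3) : ℂ :=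
  ∑ i : Fin 2, ((inner ℝ (D.n x) (outwardNormal (D.Ω i) x) : ℝ) : ℂ) * D.trace i p x

/-- The average flux `{∂p/∂n} = (∂p₁/∂n + ∂p₂/∂n) / 2` on the interface. -/
def avgFlux (D : SplitDomain) (p : R3 → ℂ) (x : R3) : ℂ :=
  (1 / 2 : ℂ) * (D.normalDeriv 0 p x + D.normalDeriv 1 p x)

end SplitDomain

/-- The partial derivative `∂_j p`. For functions that are continuous and piecewise polynomial with
respect to a mesh, this is (almost everywhere) the weak partial derivative. -/
def partialDeriv (p : R3 → ℂ) (j : Fin 3) (x : R3) : ℂ :=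
  fderiv ℝ p x (EuclideanSpace.single j 1)

/-- The bilinear product `∇p ⬝ ∇q` at `x` (without conjugation). -/
def gradDot (p q : R3 → ℂ) (x : R3) : ℂ := ∑ j, partialDeriv p j x * partialDeriv q j x

/-- `|∇p|²` at `x`. -/
def gradSq (p : R3 → ℂ) (x : R3) : ℝ := ∑ j, ‖partialDeriv p j x‖ ^ 2

/-- Tetrahedral triangulations `T 0` of `closure (Ω 0)` and `T 1` of `closure (Ω 1)`: finite
simplicial complexes whose faces are all contained in tetrahedra. Nothing is required of how the
two match on the interface. -/
structure MeshPair (D : SplitDomain) where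
  /-- the two triangulations -/
  T : Fin 2 → Geometry.SimplicialComplex ℝ R3
  finite : ∀ i, (T i).faces.Finite
  pure : ∀ i, ∀ s ∈ (T i).faces, ∃ t ∈ (T i).faces, t.card = 4 ∧ s ⊆ t
  space_eq : ∀ i, (T i).space = closure (D.Ω i)

/-- The (closed) tetrahedron, or lower-dimensional simplex, with vertex set `s`. -/
def cell (s : Finset R3) : Set R3 := convexHull ℝ (s : Set R3)

/-- The diameter `ρ_K` of the largest ball contained in `K`. -/
def ballDiam (K : Set R3) : ℝ :=
  sSup {d : ℝ | 0 ≤ d ∧ ∃ c : R3, Metric.closedBall c (d / 2) ⊆ K}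

namespace MeshPair

variable {D : SplitDomain}

/-- The vertex sets of the elements (tetrahedra) of the `i`-th triangulation. -/
def elements (M : MeshPair D) (i : Fin 2) : Set (Finset R3) :=
  {s | s ∈ (M.T i).faces ∧ s.card = 4}

/-- The mesh size `h`: the largest diameter of an element of either triangulation. -/
def meshSize (M : MeshPair D) : ℝ :=
  sSup {d : ℝ | ∃ i, ∃ s ∈ M.elements i, d = Metric.diam (cell s)}

/-- Non-degeneracy with constant `σ`: `h_K ≤ σ ρ_K` for all elements `K`. -/
def NonDegenerate (M : MeshPair D) (σ : ℝ) : Prop :=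
  ∀ i, ∀ s ∈ M.elements i, Metric.diam (cell s) ≤ σ * ballDiam (cell s)

/-- Quasi-uniformity with constant `τ`: `h ≤ τ h_K` for all elements `K`. -/
def QuasiUniform (M : MeshPair D) (τ : ℝ) : Prop :=
  ∀ i, ∀ s ∈ M.elements i, M.meshSize ≤ τ * Metric.diam (cell s)

/-- The space `V_i^h`: complex functions that are continuous on `Ω i`, agree with a polynomial of
total degree at most `k` on each element, and vanish outside `Ω i`. -/
def subdomainSpace (M : MeshPair D) (k : ℕ) (i : Fin 2) : Submodule ℂ (R3 → ℂ) where
  carrier := {v | ContinuousOn v (D.Ω i) ∧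
    (∀ s ∈ M.elements i, ∃ P : MvPolynomial (Fin 3) ℂ, P.totalDegree ≤ k ∧
      ∀ x ∈ cell s ∩ D.Ω i, v x = MvPolynomial.eval (fun j => (x j : ℂ)) P) ∧
    ∀ x, x ∉ D.Ω i → v x = 0}
  zero_mem' := ⟨continuousOn_const, fun _ _ => ⟨0, by simp, by simp⟩, by simp⟩
  add_mem' := by
    rintro v w ⟨hv, hv', hv0⟩ ⟨hw, hw', hw0⟩
    refine ⟨hv.add hw, fun s hs => ?_, fun x hx => by simp [hv0 x hx, hw0 x hx]⟩
    obtain ⟨P, hP, hPv⟩ := hv' s hs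
    obtain ⟨Q, hQ, hQw⟩ := hw' s hs
    exact ⟨P + Q, (MvPolynomial.totalDegree_add P Q).trans (max_le hP hQ),
      fun x hx => by simp [hPv x hx, hQw x hx]⟩
  smul_mem' := by
    rintro c v ⟨hv, hv', hv0⟩
    refine ⟨hv.const_smul c, fun s hs => ?_, fun x hx => by simp [hv0 x hx]⟩
    obtain ⟨P, hP, hPv⟩ := hv' s hs
    exact ⟨c • P, (MvPolynomial.totalDegree_smul_le c P).trans hP,
      fun x hx => by simp [hPv x hx]⟩

/-- The finite element space `V_h = V_1^h + V_2^h`. -/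
def feSpace (M : MeshPair D) (k : ℕ) : Submodule ℂ (R3 → ℂ) :=
  M.subdomainSpace k 0 ⊔ M.subdomainSpace k 1

/-- `C` is a constant in the inverse inequality
`∫_{Γ_I} h |{∂p/∂n}|² ≤ C ∫_{Ω₁ ∪ Ω₂} |∇p|²` for all `p` in the finite element space. -/
def InverseInequality (M : MeshPair D) (k : ℕ) (C : ℝ) : Prop :=
  ∀ p ∈ M.feSpace k,
    ∫ x in D.ΓI, M.meshSize * ‖D.avgFlux p x‖ ^ 2 ∂surfaceMeasure ≤
      C * ∫ x in D.Ω 0 ∪ D.Ω 1, gradSq p x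

end MeshPair

/-- The function `λ = (h/γ + ζ/(iκ))⁻¹`. -/
def nitscheLambda (κ γ h : ℝ) (ζ : R3 → ℂ) (x : R3) : ℂ :=
  ((h : ℂ) / γ + ζ x / (Complex.I * κ))⁻¹

namespace SplitDomain

/-- The bilinear form `a₀`. -/
def formZero (D : SplitDomain) (κ : ℝ) (p q : R3 → ℂ) : ℂ :=
  (∫ x in D.Ω 0 ∪ D.Ω 1, gradDot p q x)
    - (κ : ℂ) ^ 2 * (∫ x in D.Ω 0 ∪ D.Ω 1, p x * q x)
    + Complex.I * κ *
      ∑ i : Fin 2, ∫ x in D.Γio ∩ frontier (D.Ω i), D.trace i p x * D.trace i q x ∂surfaceMeasure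

/-- The expression `⟦p⟧ + ζ/(iκ) {∂p/∂n}` on the interface. -/
def residual (D : SplitDomain) (κ : ℝ) (ζ : R3 → ℂ) (p : R3 → ℂ) (x : R3) : ℂ :=
  D.jump p x + ζ x / (Complex.I * κ) * D.avgFlux p x

/-- The bilinear form `a_λ` of Nitsche type. -/
def formLambda (D : SplitDomain) (κ : ℝ) (ζ lam : R3 → ℂ) (p q : R3 → ℂ) : ℂ :=
  D.formZero κ p q
    - (∫ x in D.ΓI, D.avgFlux p x * D.residual κ ζ q x ∂surfaceMeasure)
    - (∫ x in D.ΓI, D.residual κ ζ p x * D.avgFlux q x ∂surfaceMeasure)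
    + (∫ x in D.ΓI, ζ x / (Complex.I * κ) * D.avgFlux p x * D.avgFlux q x ∂surfaceMeasure)
    + (∫ x in D.ΓI, lam x * D.residual κ ζ p x * D.residual κ ζ q x ∂surfaceMeasure)

/-- The map `J q = (√κ q, ⟦q⟧ / √δ)` into `U = L²(Ω₁ ∪ Ω₂) × L²(Γ_I⁻)`. -/
def mapJ (D : SplitDomain) (κ δ : ℝ) (q : R3 → ℂ) : (R3 → ℂ) × (R3 → ℂ) :=
  (fun x => (Real.sqrt κ : ℂ) * q x, fun x => D.jump q x / (Real.sqrt δ : ℂ))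

/-- The square of the norm of `U = L²(Ω₁ ∪ Ω₂) × L²(Γ_I⁻)`. -/
def normSqU (D : SplitDomain) (ζ : R3 → ℂ) (f : (R3 → ℂ) × (R3 → ℂ)) : ℝ :=
  (∫ x in D.Ω 0 ∪ D.Ω 1, ‖f.1 x‖ ^ 2) + ∫ x in D.ΓIminus ζ, ‖f.2 x‖ ^ 2 ∂surfaceMeasure

/-- The square of the mesh- and wave-number-dependent norm `|||p|||`. -/
def tripleNormSq (D : SplitDomain) (κ γ h : ℝ) (lam : R3 → ℂ) (p : R3 → ℂ) : ℝ :=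
  (∫ x in D.Ω 0 ∪ D.Ω 1, gradSq p x) + κ ^ 2 * (∫ x in D.Ω 0 ∪ D.Ω 1, ‖p x‖ ^ 2)
    + 1 / γ * (∫ x in D.ΓI, h * ‖D.avgFlux p x‖ ^ 2 ∂surfaceMeasure)
    + ∫ x in D.ΓI, ‖lam x‖ * ‖D.jump p x‖ ^ 2 ∂surfaceMeasure

end SplitDomain

end

noncomputable section

/-! Put η = h/γ, z = ζ/(iκ) and w = η + z, so that λ = 1/w, and write J for the jump and F for the
average flux of p. For q = conj p the four interface integrands collapse to λ|J − ηF|² − η|F|²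
(`nitsche_interface_identity`), so the form equals ∫|∇p|² − κ²∫|p|² + iκb + ∫λ|J − ηF|² − ∫η|F|²
with some b ≥ 0.

Since Re ζ ≥ 0, Im λ ≥ 0 throughout. The sum of real and imaginary part of the form, which is at
most 3/2 times its modulus, therefore contains (Re λ + Im λ)|J − ηF|². Where Im ζ ≥ 0, also Re λ ≥
0, so Re λ + Im λ ≥ |λ|, and η|λ| ≤ 1 lets |J| be recovered from J − ηF and F
(`quarter_le_of_nonneg`). Where Im ζ < 0, Re λ may be negative, but the lower bound on |ζ| and the
smallness of h keep |λ| below 4κ/(3δ), and the loss is paid by the jump part of 2κ‖Jp‖²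
(`quarter_le_of_im_nonneg`). Its volume part pays for −κ²∫|p|². The flux terms are absorbed in
∫|∇p|² by the inverse inequality and γ ≥ 16 C_I.

The inverse inequality is local. On an element K, equivalence of norms on polynomials of bounded
degree and scaling bound h_K³|∇p|² pointwise by ∫_K|∇p|²; a face has area at most a multiple of
h_K², and h ≤ τh_K supplies the third power. To use this, boundary integrals must reduce to faces:
off the edges, a boundary point lies in exactly one element, and the domain coincides with the
interior of that element nearby (`eventually_mem_iff_mem_interior_cell`). Hence traces are values of
polynomials and normals are constant on faces, almost everywhere for surface measure. -/

/-- The complex valued function on three-space given by a polynomial. -/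
def polyFun (P : MvPolynomial (Fin 3) ℂ) (x : R3) : ℂ :=
  MvPolynomial.eval (fun j => (x j : ℂ)) P

/-! ### Polynomials: derivatives, affine substitution, equivalence of norms on balls. -/

section Polynomials

open MvPolynomial

theorem contDiff_polyFun (P : MvPolynomial (Fin 3) ℂ) (n : WithTop ℕ∞) :
    ContDiff ℝ n (polyFun P) := by
  unfold polyFun
  induction P using MvPolynomial.induction_on with
  | C a => simpa using contDiff_const
  | add p q hp hq => simpa using hp.add hq
  | mul_X p i hp =>
    have hX : ContDiff ℝ n fun x : R3 => ((x i : ℝ) : ℂ) :=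
      Complex.ofRealCLM.contDiff.comp (EuclideanSpace.proj (𝕜 := ℝ) i).contDiff
    simpa using hp.mul hX

theorem continuous_polyFun (P : MvPolynomial (Fin 3) ℂ) : Continuous (polyFun P) :=
  (contDiff_polyFun P 0).continuous

theorem differentiable_polyFun (P : MvPolynomial (Fin 3) ℂ) : Differentiable ℝ (polyFun P) :=
  (contDiff_polyFun P 1).differentiable one_ne_zero

theorem partialDeriv_polyFun (P : MvPolynomial (Fin 3) ℂ) (j : Fin 3) (x : R3) :
    partialDeriv (polyFun P) j x = polyFun (pderiv j P) x := by
  unfold partialDeriv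
  induction P using MvPolynomial.induction_on with
  | C a =>
    have : polyFun (C a) = fun _ => a := by ext y; simp [polyFun]
    rw [this]; simp [polyFun]
  | add p q hp hq =>
    have : polyFun (p + q) = polyFun p + polyFun q := by ext y; simp [polyFun]
    rw [this, fderiv_add (differentiable_polyFun p x) (differentiable_polyFun q x)]
    simp only [add_apply, hp, hq]
    simp [polyFun]
  | mul_X p i hp =>
    have hX : HasFDerivAt (fun x : R3 => ((x i : ℝ) : ℂ))
        (Complex.ofRealCLM.comp (EuclideanSpace.proj (𝕜 := ℝ) i)) x :=
      (Complex.ofRealCLM.comp (EuclideanSpace.proj (𝕜 := ℝ) i)).hasFDerivAt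
    have : polyFun (p * X i) = polyFun p * fun x : R3 => ((x i : ℝ) : ℂ) := by
      ext y; simp [polyFun]
    rw [this, ((differentiable_polyFun p x).hasFDerivAt.mul hX).fderiv]
    simp only [add_apply, smul_apply, hp]
    by_cases hij : i = j
    · subst hij; simp [polyFun, mul_comm]
    · simp [polyFun, pderiv_X, hij, mul_comm]

theorem totalDegree_pderiv_le (P : MvPolynomial (Fin 3) ℂ) (j : Fin 3) :
    (pderiv j P).totalDegree ≤ P.totalDegree := by
  conv_lhs => rw [P.as_sum, map_sum]
  refine totalDegree_finsetSum_le fun m hm => ?_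
  rw [pderiv_monomial]
  refine (totalDegree_monomial_le _ _).trans ?_
  refine le_trans ?_ (le_totalDegree hm)
  exact Finsupp.degree_mono tsub_le_self

theorem exists_polyFun_affine (P : MvPolynomial (Fin 3) ℂ) (c : R3) (r : ℝ) :
    ∃ Q : MvPolynomial (Fin 3) ℂ, Q.totalDegree ≤ P.totalDegree ∧
      ∀ y, polyFun Q y = polyFun P (c + r • y) := by
  let L : Fin 3 → MvPolynomial (Fin 3) ℂ := fun j => C (c j : ℂ) + C (r : ℂ) * X j
  have hL : ∀ j, (L j).totalDegree ≤ 1 := fun j => by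
    refine (totalDegree_add _ _).trans (max_le (by simp) ?_)
    refine (totalDegree_mul _ _).trans (by simp [totalDegree_X])
  refine ⟨bind₁ L P, ?_, fun y => ?_⟩
  · conv_lhs => rw [P.as_sum, map_sum]
    refine totalDegree_finsetSum_le fun m hm => ?_
    refine le_trans ?_ (le_totalDegree hm)
    rw [bind₁_monomial]
    refine (totalDegree_mul _ _).trans ?_
    rw [totalDegree_C, zero_add]
    refine (totalDegree_finsetProd _ _).trans ?_
    refine Finset.sum_le_sum fun j _ => ?_
    refine (totalDegree_pow _ _).trans ?_
    simpa using Nat.mul_le_mul_left (m j) (hL j)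
  · have : bind₁ L P = aeval L P := rfl
    simp only [polyFun]
    rw [← MvPolynomial.coe_aeval_eq_eval, ← MvPolynomial.coe_aeval_eq_eval]
    change aeval _ (bind₁ L P) = aeval _ P
    rw [aeval_bind₁]
    congr 2
    ext j
    simp [L]

theorem polyFun_eq_zero_of_ae {P : MvPolynomial (Fin 3) ℂ}
    (h : polyFun P =ᵐ[volume.restrict (Metric.ball (0 : R3) 1)] 0) : P = 0 := by
  have hP : Set.EqOn (polyFun P) 0 (Metric.ball (0 : R3) 1) :=
    Measure.eqOn_open_of_ae_eq h Metric.isOpen_ball (continuous_polyFun P).continuousOn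
      continuousOn_const
  refine MvPolynomial.funext_set
    -- A polynomial vanishing on a product of infinite sets is zero. The cube (0, 1/3)³ lies in the
    -- unit ball because 3 · (1/3)² < 1.
    (fun _ : Fin 3 => (fun t : ℝ => (t : ℂ)) '' Set.Ioo (0 : ℝ) (1 / 3)) (fun _ => ?_) fun x hx => ?_
  · exact (Set.Ioo_infinite (by norm_num)).image Complex.ofReal_injective.injOn
  · choose! y hy hyx using fun i => hx i (Set.mem_univ i)
    obtain rfl : (fun i => (y i : ℂ)) = x := funext hyx
    have := hP (x := WithLp.toLp 2 y) (by
      rw [mem_ball_zero_iff, EuclideanSpace.norm_eq, Real.sqrt_lt' one_pos]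
      have h3 : ∀ i, ‖y i‖ ^ 2 ≤ (1 / 3) ^ 2 := fun i => by
        have h1 := (hy i).1
        have h2 := (hy i).2
        rw [Real.norm_of_nonneg h1.le]
        gcongr
      simp only [Fin.sum_univ_three]
      linarith [h3 0, h3 1, h3 2])
    simpa [polyFun] using this

theorem memLp_polyFun (P : MvPolynomial (Fin 3) ℂ) :
    MemLp (polyFun P) 2 (volume.restrict (Metric.ball (0 : R3) 1)) := by
  refine (memLp_two_iff_integrable_sq_norm
    (continuous_polyFun P).aestronglyMeasurable).2 ?_
  have : IntegrableOn (fun x => ‖polyFun P x‖ ^ 2) (Metric.closedBall (0 : R3) 1) :=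
    ((continuous_polyFun P).norm.pow 2).continuousOn.integrableOn_compact
      (isCompact_closedBall 0 1)
  exact this.mono_set Metric.ball_subset_closedBall

/-- A polynomial as a square integrable function on the unit ball. -/
def polyLp (k : ℕ) : restrictTotalDegree (Fin 3) ℂ k →ₗ[ℂ]
    Lp ℂ 2 (volume.restrict (Metric.ball (0 : R3) 1)) where
  toFun P := (memLp_polyFun P.1).toLp
  map_add' P Q := by
    rw [← MemLp.toLp_add]
    congr 1
    ext x; simp [polyFun]
  map_smul' c P := by
    rw [RingHom.id_apply, ← MemLp.toLp_const_smul]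
    congr 1
    ext x; simp [polyFun]

theorem polyLp_injective (k : ℕ) : Function.Injective (polyLp k) := by
  rw [injective_iff_map_eq_zero]
  intro P hP
  have h : (memLp_polyFun P.1).toLp = 0 := hP
  have h' := (memLp_polyFun P.1).coeFn_toLp
  rw [h] at h'
  exact Subtype.ext (polyFun_eq_zero_of_ae (h'.symm.trans (Lp.coeFn_zero _ _ _)))

/-- A polynomial as a continuous function on a closed ball. -/
def polyCont (k : ℕ) (R : ℝ) : restrictTotalDegree (Fin 3) ℂ k →ₗ[ℂ]
    C(Metric.closedBall (0 : R3) R, ℂ) where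
  toFun P := ⟨fun x => polyFun P.1 x, (continuous_polyFun P.1).comp continuous_subtype_val⟩
  map_add' P Q := by ext x; simp [polyFun]
  map_smul' c P := by ext x; simp [polyFun]

/-- Polynomials of degree at most k form a finite-dimensional space that embeds in L² of the unit
ball. The map from the image back to polynomials and on to continuous functions on the larger ball
is linear on a finite-dimensional space, hence bounded. -/
theorem exists_sq_norm_polyFun_le (k : ℕ) (R : ℝ) : ∃ C : ℝ, 0 ≤ C ∧
    ∀ P : MvPolynomial (Fin 3) ℂ, P.totalDegree ≤ k → ∀ x ∈ Metric.closedBall (0 : R3) R,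
      ‖polyFun P x‖ ^ 2 ≤ C * ∫ y in Metric.ball (0 : R3) 1, ‖polyFun P y‖ ^ 2 := by
  let e := LinearEquiv.ofInjective (polyLp k) (polyLp_injective k)
  let T := (polyCont k R ∘ₗ e.symm.toLinearMap).toContinuousLinearMap
  refine ⟨‖T‖ ^ 2, by positivity, fun P hP x hx => ?_⟩
  let P' : restrictTotalDegree (Fin 3) ℂ k := ⟨P, (mem_restrictTotalDegree _ _ _).2 hP⟩
  have h1 : T (e P') = polyCont k R P' := by simp [T]
  have h2 : ‖polyFun P x‖ ≤ ‖T‖ * ‖e P'‖ := by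
    refine le_trans ?_ (T.le_opNorm _)
    rw [h1]
    exact (polyCont k R P').norm_coe_le_norm ⟨x, hx⟩
  have h3 : ‖e P'‖ ^ 2 = ∫ y in Metric.ball (0 : R3) 1, ‖polyFun P y‖ ^ 2 := by
    have h4 : ‖e P'‖ = ‖(memLp_polyFun P).toLp‖ := rfl
    rw [h4, Lp.norm_toLp, (memLp_polyFun P).eLpNorm_eq_integral_rpow_norm two_ne_zero (by simp),
      ENNReal.toReal_ofReal (by positivity)]
    simp only [ENNReal.toReal_ofNat, Real.rpow_ofNat]
    rw [← Real.rpow_natCast, ← Real.rpow_mul (by positivity)]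
    norm_num
  rw [← h3, ← mul_pow]
  gcongr

/-- Translation and dilation preserve the degree bound, so one constant serves all balls; r³ is the
Jacobian of the dilation. -/
theorem exists_sq_norm_polyFun_le_ball (k : ℕ) (R : ℝ) : ∃ C : ℝ, 0 ≤ C ∧
    ∀ P : MvPolynomial (Fin 3) ℂ, P.totalDegree ≤ k → ∀ (c : R3) (r : ℝ), 0 < r →
      ∀ x ∈ Metric.closedBall c (R * r),
        ‖polyFun P x‖ ^ 2 * r ^ 3 ≤ C * ∫ y in Metric.ball c r, ‖polyFun P y‖ ^ 2 := by
  obtain ⟨C, hC0, hC⟩ := exists_sq_norm_polyFun_le k R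
  refine ⟨C, hC0, fun P hP c r hr x hx => ?_⟩
  obtain ⟨Q, hQ, hQP⟩ := exists_polyFun_affine P c r
  have h1 := hC Q (hQ.trans hP) (r⁻¹ • (x - c)) (by
    rw [mem_closedBall_iff_norm] at hx
    rw [mem_closedBall_zero_iff, norm_smul, Real.norm_of_nonneg (by positivity),
      inv_mul_le_iff₀ hr, mul_comm]
    exact hx)
  have h2 : c + r • r⁻¹ • (x - c) = x := by rw [smul_inv_smul₀ hr.ne']; abel
  rw [hQP, h2] at h1
  simp only [hQP] at h1
  have h3 : ∫ y in Metric.ball (0 : R3) 1, ‖polyFun P (c + r • y)‖ ^ 2 =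
      (r ^ 3)⁻¹ * ∫ y in Metric.ball c r, ‖polyFun P y‖ ^ 2 := by
    rw [Measure.setIntegral_comp_smul volume (fun y => ‖polyFun P (c + y)‖ ^ 2) _ hr.ne',
      smul_unitBall hr.ne', Real.norm_of_nonneg hr.le, finrank_euclideanSpace, Fintype.card_fin,
      abs_of_nonneg (by positivity), smul_eq_mul]
    congr 1
    have h4 : (fun y => c + y) ⁻¹' Metric.ball c r = Metric.ball 0 r := by
      ext y; simp
    rw [← h4]
    exact (measurePreserving_add_left volume c).setIntegral_preimage_emb
      (measurableEmbedding_addLeft c) (fun y => ‖polyFun P y‖ ^ 2) _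
  rw [h3] at h1
  have h5 : 0 < r ^ 3 := by positivity
  calc _ ≤ (C * ((r ^ 3)⁻¹ * ∫ y in Metric.ball c r, ‖polyFun P y‖ ^ 2)) * r ^ 3 := by gcongr
    _ = _ := by field_simp

end Polynomials

/-! ### Surface measure of segments and triangles. -/

section Area

/-- The normalising factor never matters, only its finiteness. The separate real exponent `d` allows
the literals `1` and `2` in place of casts. -/
theorem exists_euclideanHausdorffMeasure_eq_smul (n : ℕ) (d : ℝ) (h : (n : ℝ) = d) :
    ∃ c : NNReal, (Measure.euclideanHausdorffMeasure n : Measure R3) =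
      c • Measure.hausdorffMeasure d := by
  subst h
  exact ⟨_, Measure.euclideanHausdorffMeasure_def n⟩

/-- A set of finite one-dimensional measure is null in dimension two. -/
theorem surfaceMeasure_segment (a b : R3) : surfaceMeasure (segment ℝ a b) = 0 := by
  refine (Measure.euclideanHausdorffMeasure_zero_or_top one_lt_two (segment ℝ a b)).resolve_right ?_
  obtain ⟨c, hc⟩ := exists_euclideanHausdorffMeasure_eq_smul 1 1 Nat.cast_one
  rw [hc, Measure.smul_apply, hausdorffMeasure_segment]
  exact ENNReal.mul_ne_top ENNReal.coe_ne_top (edist_ne_top _ _)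

/-- The triangle lies in a parallelogram, the image of the unit square under a 2d-Lipschitz affine
map for the sup metric. In that metric the two-dimensional Hausdorff measure of the plane is
Lebesgue measure. -/
theorem hausdorffMeasure_triangle_le (a b c : R3) (d : NNReal) (hb : dist a b ≤ d)
    (hc : dist a c ≤ d) : Measure.hausdorffMeasure 2 (convexHull ℝ {a, b, c}) ≤ (2 * d) ^ 2 := by
  let f : ℝ × ℝ → R3 := fun u => a + u.1 • (b - a) + u.2 • (c - a)
  have hf : LipschitzWith (2 * d) f := by
    refine LipschitzWith.of_dist_le_mul fun u v => ?_
    have h1 : f u - f v = (u.1 - v.1) • (b - a) + (u.2 - v.2) • (c - a) := by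
      simp only [f]; module
    rw [dist_eq_norm, h1]
    refine (norm_add_le _ _).trans ?_
    rw [norm_smul, norm_smul, ← dist_eq_norm, ← dist_eq_norm, ← dist_eq_norm, ← dist_eq_norm,
      dist_comm b a, dist_comm c a, Prod.dist_eq]
    calc _ ≤ max (dist u.1 v.1) (dist u.2 v.2) * d + max (dist u.1 v.1) (dist u.2 v.2) * d := by
          gcongr
          · exact le_max_left _ _
          · exact le_max_right _ _
      _ = _ := by push_cast; ring
  have hsub : convexHull ℝ {a, b, c} ⊆ f '' (Set.Icc (0 : ℝ) 1 ×ˢ Set.Icc (0 : ℝ) 1) := by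
    have hconv : Convex ℝ (f '' (Set.Icc (0 : ℝ) 1 ×ˢ Set.Icc (0 : ℝ) 1)) := by
      let g : ℝ × ℝ →ₗ[ℝ] R3 := LinearMap.coprod (LinearMap.toSpanSingleton ℝ R3 (b - a))
        (LinearMap.toSpanSingleton ℝ R3 (c - a))
      have h2 : f '' (Set.Icc (0 : ℝ) 1 ×ˢ Set.Icc (0 : ℝ) 1) =
          (fun y => a + y) '' (g '' (Set.Icc (0 : ℝ) 1 ×ˢ Set.Icc (0 : ℝ) 1)) := by
        rw [Set.image_image]
        refine Set.image_congr fun u _ => ?_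
        simp [f, g, add_assoc]
      rw [h2]
      exact (((convex_Icc 0 1).prod (convex_Icc 0 1)).linear_image g).translate a
    refine convexHull_min ?_ hconv
    rintro y (rfl | rfl | rfl)
    · exact ⟨(0, 0), by simp, by simp [f]⟩
    · exact ⟨(1, 0), by simp, by simp [f]⟩
    · exact ⟨(0, 1), by simp, by simp [f]⟩
  refine (measure_mono hsub).trans ?_
  refine (hf.hausdorffMeasure_image_le zero_le_two _).trans ?_
  rw [hausdorffMeasure_prod_real, Measure.volume_eq_prod, Measure.prod_prod]
  simp

theorem exists_surfaceMeasure_triangle_le : ∃ A : ℝ, 0 ≤ A ∧ ∀ (t : Finset R3), t.card = 3 →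
    ∀ d : ℝ, (∀ x ∈ t, ∀ y ∈ t, dist x y ≤ d) →
      surfaceMeasure (cell t) ≤ ENNReal.ofReal (A * d ^ 2) := by
  classical
  obtain ⟨κ, hκ⟩ := exists_euclideanHausdorffMeasure_eq_smul 2 2 (Nat.cast_ofNat)
  refine ⟨κ * 4, by positivity, fun t ht d hd => ?_⟩
  obtain ⟨a, b, c, -, -, -, rfl⟩ := Finset.card_eq_three.1 ht
  have hd0 : 0 ≤ d := dist_nonneg.trans (hd a (by simp) a (by simp))
  lift d to NNReal using hd0
  have h := hausdorffMeasure_triangle_le a b c d (hd _ (by simp) _ (by simp))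
    (hd _ (by simp) _ (by simp))
  rw [surfaceMeasure, hκ, Measure.smul_apply, cell]
  push_cast
  calc _ ≤ (κ : ENNReal) * (2 * d) ^ 2 := by
        rw [ENNReal.smul_def, smul_eq_mul]; gcongr
    _ = _ := by
      have : (κ * 4 * (d : ℝ) ^ 2) = ((κ * (2 * d) ^ 2 : NNReal) : ℝ) := by push_cast; ring
      rw [this, ENNReal.ofReal_coe_nnreal]
      push_cast; rfl

end Area

/-! ### Barycentric coordinates of an element. -/

namespace MeshPair

variable {D : SplitDomain}

section Basis

variable (M : MeshPair D) {i : Fin 2} {s : Finset R3}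

/-- The barycentric coordinates of an element. -/
def basis (hs : s ∈ M.elements i) : AffineBasis s ℝ R3 :=
  ⟨Subtype.val, (M.T i).indep hs.1, by
    rw [((M.T i).indep hs.1).affineSpan_eq_top_iff_card_eq_finrank_add_one]
    simpa using hs.2⟩

theorem basis_apply (hs : s ∈ M.elements i) (v : s) : M.basis hs v = v := rfl

theorem range_basis (hs : s ∈ M.elements i) : Set.range (M.basis hs) = (s : Set R3) :=
  Subtype.range_coe

theorem mem_cell_iff (hs : s ∈ M.elements i) {x : R3} :
    x ∈ cell s ↔ ∀ v, 0 ≤ (M.basis hs).coord v x := by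
  rw [cell, ← M.range_basis hs, AffineBasis.convexHull_eq_nonneg_coord]; rfl

theorem mem_interior_cell_iff (hs : s ∈ M.elements i) {x : R3} :
    x ∈ interior (cell s) ↔ ∀ v, 0 < (M.basis hs).coord v x := by
  rw [cell, ← M.range_basis hs, AffineBasis.interior_convexHull]; rfl

theorem interior_cell_nonempty (hs : s ∈ M.elements i) : (interior (cell s)).Nonempty := by
  rw [cell, ← M.range_basis hs]
  exact ⟨_, (M.basis hs).centroid_mem_interior_convexHull⟩

theorem continuous_coord (hs : s ∈ M.elements i) (v : s) :
    Continuous ((M.basis hs).coord v) :=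
  ((M.basis hs).coord v).continuous_of_finiteDimensional

theorem coord_eq_zero_of_mem_convexHull (hs : s ∈ M.elements i) (v : s) {t : Set R3}
    (hts : t ⊆ s) (hv : (v : R3) ∉ t) {x : R3} (hx : x ∈ convexHull ℝ t) :
    (M.basis hs).coord v x = 0 := by
  have hconv : Convex ℝ ((M.basis hs).coord v ⁻¹' {0}) :=
    (convex_singleton 0).affine_preimage ((M.basis hs).coord v)
  have hsub : t ⊆ (M.basis hs).coord v ⁻¹' {0} := by
    intro y hy
    have hne : v ≠ ⟨y, hts hy⟩ := by rintro rfl; exact hv hy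
    have h0 := (M.basis hs).coord_apply_ne hne
    rw [M.basis_apply hs] at h0
    exact h0
  have h : x ∈ (M.basis hs).coord v ⁻¹' {0} := convexHull_min hsub hconv hx
  exact Set.mem_singleton_iff.1 (Set.mem_preimage.1 h)

theorem mem_convexHull_of_coord_eq_zero (hs : s ∈ M.elements i) {t : Set R3} {x : R3}
    (hx : x ∈ cell s) (h : ∀ v : s, (v : R3) ∉ t → (M.basis hs).coord v x = 0) :
    x ∈ convexHull ℝ t := by
  classical
  rw [M.mem_cell_iff hs] at hx
  have h1 := (M.basis hs).linear_combination_coord_eq_self x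
  have h2 := (M.basis hs).sum_coord_apply_eq_one x
  let u : Finset s := {v | (v : R3) ∈ t}
  have hu : ∀ v, v ∉ u → (M.basis hs).coord v x = 0 := fun v hv => h v (by simpa [u] using hv)
  rw [← Finset.sum_subset u.subset_univ (fun v _ hv => by rw [hu v hv, zero_smul])] at h1
  rw [← Finset.sum_subset u.subset_univ (fun v _ hv => hu v hv)] at h2
  rw [← h1]
  refine (convex_convexHull ℝ t).sum_mem (fun v _ => hx v) h2 fun v hv => ?_
  exact subset_convexHull ℝ t (show (v : R3) ∈ t by simpa [u] using hv)

end Basis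

end MeshPair

/-! ### The triangulation near a boundary point off the edges. -/

namespace MeshPair

variable {D : SplitDomain} (M : MeshPair D) {i : Fin 2} {s : Finset R3}

theorem finite_elements (i : Fin 2) : (M.elements i).Finite :=
  (M.finite i).subset fun _ hs => hs.1

theorem closure_eq_biUnion_cell (i : Fin 2) :
    closure (D.Ω i) = ⋃ s ∈ M.elements i, cell s := by
  rw [← M.space_eq i]
  ext x
  simp only [Geometry.SimplicialComplex.mem_space_iff, Set.mem_iUnion₂, exists_prop]
  constructor
  · rintro ⟨s, hs, hx⟩
    obtain ⟨t, ht, ht4, hst⟩ := M.pure i s hs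
    exact ⟨t, ⟨ht, ht4⟩, convexHull_mono (Finset.coe_subset.2 hst) hx⟩
  · rintro ⟨s, hs, hx⟩
    exact ⟨s, hs.1, hx⟩

theorem cell_subset_closure (hs : s ∈ M.elements i) : cell s ⊆ closure (D.Ω i) := by
  rw [M.closure_eq_biUnion_cell]
  exact Set.subset_biUnion_of_mem (u := cell) hs

theorem interior_cell_subset (hs : s ∈ M.elements i) : interior (cell s) ⊆ D.Ω i := by
  rw [← D.interior_closure i]
  exact interior_mono (M.cell_subset_closure hs)

theorem isCompact_cell (s : Finset R3) : IsCompact (cell s) :=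
  s.finite_toSet.isCompact_convexHull ℝ

theorem inter_cell_subset {t : Finset R3} (hs : s ∈ M.elements i) (ht : t ∈ M.elements i) :
    cell s ∩ cell t ⊆ convexHull ℝ ((s : Set R3) ∩ t) :=
  (M.T i).inter_subset_convexHull hs.1 ht.1

theorem exists_mem_notMem {t : Finset R3} (hs : s ∈ M.elements i) (ht : t ∈ M.elements i)
    (hst : s ≠ t) : ∃ v ∈ s, v ∉ t := by
  by_contra! h
  exact hst (Finset.eq_of_subset_of_card_le h (by rw [hs.2, ht.2]))

theorem disjoint_interior_cell {t : Finset R3} (hs : s ∈ M.elements i) (ht : t ∈ M.elements i)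
    (hst : s ≠ t) : Disjoint (interior (cell s)) (interior (cell t)) := by
  rw [Set.disjoint_left]
  intro x hxs hxt
  obtain ⟨v, hv, hvt⟩ := M.exists_mem_notMem hs ht hst
  have h0 := M.coord_eq_zero_of_mem_convexHull hs ⟨v, hv⟩ Set.inter_subset_left
    (fun h => hvt h.2) (M.inter_cell_subset hs ht ⟨interior_subset hxs, interior_subset hxt⟩)
  exact ((M.mem_interior_cell_iff hs).1 hxs ⟨v, hv⟩).ne' h0

/-- The union of the edges of the `i`-th triangulation. -/
def edges (i : Fin 2) : Set R3 :=
  ⋃ s ∈ M.elements i, ⋃ a ∈ s, ⋃ b ∈ s, segment ℝ a b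

theorem surfaceMeasure_edges (i : Fin 2) : surfaceMeasure (M.edges i) = 0 := by
  refine (measure_biUnion_null_iff (M.finite_elements i).countable).2 fun s _ => ?_
  refine (measure_biUnion_null_iff s.countable_toSet).2 fun a _ => ?_
  exact (measure_biUnion_null_iff s.countable_toSet).2 fun b _ => surfaceMeasure_segment a b

/-- If no coordinate vanished, the point would be interior to the element and so to the domain; if
two vanished, it would lie on the edge spanned by the two remaining vertices. -/
theorem exists_coord_eq_zero (hs : s ∈ M.elements i) {x : R3} (hx : x ∈ cell s)
    (hΩ : x ∉ D.Ω i) (he : x ∉ M.edges i) :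
    ∃ v, (M.basis hs).coord v x = 0 ∧ ∀ w, w ≠ v → 0 < (M.basis hs).coord w x := by
  classical
  have hpos := (M.mem_cell_iff hs).1 hx
  have hint : ¬ ∀ v, 0 < (M.basis hs).coord v x := fun h =>
    hΩ (M.interior_cell_subset hs ((M.mem_interior_cell_iff hs).2 h))
  push Not at hint
  obtain ⟨v, hv⟩ := hint
  refine ⟨v, hv.antisymm (hpos v), fun w hw => (hpos w).lt_of_ne' fun hw0 => he ?_⟩
  have hcard : ((s.erase v).erase w).card = 2 := by
    rw [Finset.card_erase_of_mem, Finset.card_erase_of_mem v.2, hs.2]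
    exact Finset.mem_erase.2 ⟨fun h => hw (Subtype.ext h), w.2⟩
  obtain ⟨a, b, -, hab⟩ := Finset.card_eq_two.1 hcard
  have hmem : ∀ c ∈ ({a, b} : Finset R3), c ∈ s := fun c hc => by
    rw [← hab] at hc
    exact Finset.mem_of_mem_erase (Finset.mem_of_mem_erase hc)
  have hx' : x ∈ convexHull ℝ (((s.erase v).erase w : Finset R3) : Set R3) := by
    refine M.mem_convexHull_of_coord_eq_zero hs hx fun u hu => ?_
    by_cases huv : u = v
    · rw [huv]; exact hv.antisymm (hpos v)
    by_cases huw : u = w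
    · rw [huw]; exact hw0
    refine absurd ?_ hu
    simp [huv, huw]
  rw [hab, Finset.coe_pair, convexHull_pair] at hx'
  exact Set.mem_biUnion hs (Set.mem_biUnion (hmem a (by simp)) (Set.mem_biUnion
    (hmem b (by simp)) hx'))

theorem eventually_mem_cell_iff (hs : s ∈ M.elements i) {x : R3} {v : s}
    (h : ∀ w, w ≠ v → 0 < (M.basis hs).coord w x) :
    ∀ᶠ y in 𝓝 x, (y ∈ cell s ↔ 0 ≤ (M.basis hs).coord v y) ∧
      (y ∈ interior (cell s) ↔ 0 < (M.basis hs).coord v y) := by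
  have h1 : ∀ᶠ y in 𝓝 x, ∀ w, w ≠ v → 0 < (M.basis hs).coord w y := by
    refine Filter.eventually_all.2 fun w => ?_
    by_cases hw : w = v
    · exact Filter.Eventually.of_forall fun y h => absurd hw h
    · filter_upwards [((M.continuous_coord hs w).tendsto x).eventually_const_lt (h w hw)]
        with y hy _ using hy
  filter_upwards [h1] with y hy
  rw [M.mem_cell_iff hs, M.mem_interior_cell_iff hs]
  refine ⟨⟨fun h => h v, fun h w => ?_⟩, ⟨fun h => h v, fun h w => ?_⟩⟩
  · by_cases hw : w = v
    · rwa [hw]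
    · exact (hy w hw).le
  · by_cases hw : w = v
    · rwa [hw]
    · exact hy w hw

theorem mem_closure_interior_cell (hs : s ∈ M.elements i) {x : R3} (hx : x ∈ cell s) :
    x ∈ closure (interior (cell s)) := by
  rw [cell, (convex_convexHull ℝ _).closure_interior_eq_closure_of_nonempty_interior
    (M.interior_cell_nonempty hs)]
  exact subset_closure hx

/-- Two distinct elements through such a point share a whole face. If they lie on opposite sides of
it, they fill a neighbourhood, and the absence of cracks puts the point in the domain; if on the
same side, their interiors overlap. -/
theorem eq_of_mem_cell {t : Finset R3} (hs : s ∈ M.elements i) (ht : t ∈ M.elements i) {x : R3}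
    (hxs : x ∈ cell s) (hxt : x ∈ cell t) (hΩ : x ∉ D.Ω i) (he : x ∉ M.edges i) : s = t := by
  by_contra hst
  obtain ⟨v, hv0, hvpos⟩ := M.exists_coord_eq_zero hs hxs hΩ he
  obtain ⟨w, hw0, hwpos⟩ := M.exists_coord_eq_zero ht hxt hΩ he
  have hx := M.inter_cell_subset hs ht ⟨hxs, hxt⟩
  -- The point lies in the hull of the common vertices, so coordinates at other vertices vanish
  -- there; only one coordinate does.
  have hsv : ∀ u ∈ s, u ∉ t → u = v := fun u hu hut => by
    by_contra huv
    refine (hvpos ⟨u, hu⟩ fun h => huv (congrArg Subtype.val h)).ne' ?_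
    exact M.coord_eq_zero_of_mem_convexHull hs _ Set.inter_subset_left (fun h => hut h.2) hx
  have htw : ∀ u ∈ t, u ∉ s → u = w := fun u hu hus => by
    by_contra huw
    refine (hwpos ⟨u, hu⟩ fun h => huw (congrArg Subtype.val h)).ne' ?_
    exact M.coord_eq_zero_of_mem_convexHull ht _ Set.inter_subset_right (fun h => hus h.1) hx
  obtain ⟨v', hv's, hv't⟩ := M.exists_mem_notMem hs ht hst
  obtain rfl := hsv v' hv's hv't
  obtain ⟨w', hw't, hw's⟩ := M.exists_mem_notMem ht hs (Ne.symm hst)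
  obtain rfl := htw w' hw't hw's
  -- the two coordinate functions that vanish at `x` are proportional
  have hprop : ∀ y, (M.basis hs).coord v y =
      (M.basis hs).coord v w * (M.basis ht).coord w y := by
    intro y
    have h1 := (M.basis ht).affineCombination_coord_eq_self y
    have h2 : (M.basis hs).coord v y =
        ∑ u : t, (M.basis ht).coord u y * (M.basis hs).coord v u := by
      conv_lhs => rw [← h1]
      rw [Finset.map_affineCombination _ _ _ ((M.basis ht).sum_coord_apply_eq_one y),
        Finset.univ.affineCombination_eq_linear_combination _ _
          ((M.basis ht).sum_coord_apply_eq_one y)]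
      rfl
    rw [h2, Finset.sum_eq_single w, mul_comm]
    · intro u _ hu
      have hus : (u : R3) ∈ s := by
        by_contra h
        exact hu (Subtype.ext (htw u u.2 h))
      have : (M.basis hs).coord v (u : R3) = 0 := by
        have hne : v ≠ ⟨u, hus⟩ := fun h => hv't (h ▸ u.2)
        have h0 := (M.basis hs).coord_apply_ne hne
        rwa [M.basis_apply hs] at h0
      rw [this, mul_zero]
    · simp
  have hs' := M.eventually_mem_cell_iff hs hvpos
  have ht' := M.eventually_mem_cell_iff ht hwpos
  rcases lt_trichotomy ((M.basis hs).coord v w) 0 with hc | hc | hc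
  · -- the two elements cover a neighbourhood of `x`
    refine hΩ ?_
    rw [← D.interior_closure i, mem_interior_iff_mem_nhds]
    filter_upwards [hs', ht'] with y hy1 hy2
    by_cases h : 0 ≤ (M.basis ht).coord w y
    · exact M.cell_subset_closure ht (hy2.1.2 h)
    · refine M.cell_subset_closure hs (hy1.1.2 ?_)
      rw [hprop]
      exact mul_nonneg_of_nonpos_of_nonpos hc.le (not_le.1 h).le
  · have h1 := (M.basis hs).coord_apply_eq v
    rw [M.basis_apply hs, hprop, hc, zero_mul] at h1
    exact zero_ne_one h1
  · -- the interiors of the two elements meet near `x`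
    obtain ⟨y, hy, hys⟩ := ((mem_closure_iff_frequently.1
      (M.mem_closure_interior_cell hs hxs)).and_eventually (hs'.and ht')).exists
    refine Set.disjoint_left.1 (M.disjoint_interior_cell hs ht hst) hy (hys.2.2.2 ?_)
    have h1 := hys.1.2.1 hy
    rw [hprop] at h1
    exact (pos_iff_pos_of_mul_pos h1).1 hc

/-- The finitely many other elements are closed and miss the point, so near it the domain is
contained in this element; being open, it is contained in the interior. -/
theorem eventually_mem_iff_mem_interior_cell (hs : s ∈ M.elements i) {x : R3} (hx : x ∈ cell s)
    (hΩ : x ∉ D.Ω i) (he : x ∉ M.edges i) :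
    ∀ᶠ y in 𝓝 x, (y ∈ D.Ω i ↔ y ∈ interior (cell s)) := by
  have h1 : ∀ᶠ y in 𝓝 x, ∀ t ∈ M.elements i, y ∈ cell t → t = s := by
    refine (M.finite_elements i).eventually_all.2 fun t ht => ?_
    by_cases hxt : x ∈ cell t
    · exact Filter.Eventually.of_forall fun y _ => M.eq_of_mem_cell ht hs hxt hx hΩ he
    · filter_upwards [(isCompact_cell t).isClosed.isOpen_compl.mem_nhds hxt] with y hy hyt
        using absurd hyt hy
  filter_upwards [h1.eventually_nhds] with y hy
  refine ⟨fun hyΩ => ?_, fun hyi => M.interior_cell_subset hs hyi⟩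
  rw [mem_interior_iff_mem_nhds]
  filter_upwards [hy, (D.isOpen i).mem_nhds hyΩ] with z hz hzΩ
  have hzc := subset_closure hzΩ
  rw [M.closure_eq_biUnion_cell] at hzc
  obtain ⟨t, ht, hzt⟩ := Set.mem_iUnion₂.1 hzc
  exact hz t ht hzt ▸ hzt

theorem cell_erase_subset [DecidableEq R3] (s : Finset R3) (v : R3) :
    cell (s.erase v) ⊆ cell s :=
  convexHull_mono (Finset.coe_subset.2 (s.erase_subset v))

theorem exists_mem_face [DecidableEq R3] {x : R3} (hx : x ∈ frontier (D.Ω i))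
    (he : x ∉ M.edges i) : ∃ s ∈ M.elements i, ∃ v ∈ s, x ∈ cell (s.erase v) := by
  have hΩ : x ∉ D.Ω i := by
    rw [(D.isOpen i).frontier_eq] at hx; exact hx.2
  have hxc := frontier_subset_closure hx
  rw [M.closure_eq_biUnion_cell] at hxc
  obtain ⟨s, hs, hxs⟩ := Set.mem_iUnion₂.1 hxc
  obtain ⟨v, hv0, hvpos⟩ := M.exists_coord_eq_zero hs hxs hΩ he
  refine ⟨s, hs, v, v.2, M.mem_convexHull_of_coord_eq_zero hs hxs fun u hu => ?_⟩
  have : u = v := by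
    by_contra h
    exact hu (by simp [h])
  rw [this, hv0]

end MeshPair

/-! ### Outward normals on faces. -/

/-- Points x + t(ν′ − ν) with small t > 0 lie in the inner cone of ν and in the outer cone of ν′, so
they would be both in Ω and outside it. -/
theorem IsOutwardNormal.unique {Ω : Set R3} {x ν ν' : R3} (h : IsOutwardNormal Ω x ν)
    (h' : IsOutwardNormal Ω x ν') : ν = ν' := by
  by_contra hne
  have hlt : inner ℝ ν ν' < 1 := (inner_lt_one_iff_real_of_norm_eq_one h.1 h'.1).2 hne
  set d := ν' - ν with hd
  have hd0 : 0 < ‖d‖ := norm_pos_iff.2 (sub_ne_zero.2 (Ne.symm hne))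
  set c := 1 - inner ℝ ν ν' with hc
  have hcpos : 0 < c := sub_pos.2 hlt
  have h1 : inner ℝ d ν = -c := by
    rw [hd, inner_sub_left, real_inner_self_eq_norm_sq, h.1, real_inner_comm, hc]; ring
  have h2 : inner ℝ d ν' = c := by
    rw [hd, inner_sub_left, real_inner_self_eq_norm_sq, h'.1, hc]; ring
  have hε : 0 < c / (2 * ‖d‖) := by positivity
  have hev := (h.2 _ hε).and (h'.2 _ hε)
  have htend : Filter.Tendsto (fun t : ℝ => x + t • d) (𝓝[>] 0) (𝓝 x) := by
    have : Continuous fun t : ℝ => x + t • d := by fun_prop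
    simpa using (this.tendsto 0).mono_left nhdsWithin_le_nhds
  obtain ⟨t, ht, ht0⟩ := ((htend.eventually hev).and self_mem_nhdsWithin).exists
  have ht0 : 0 < t := ht0
  have h3 : x + t • d - x = t • d := by abel
  have h4 : c / (2 * ‖d‖) * ‖t • d‖ = t * c / 2 := by
    rw [norm_smul, Real.norm_of_nonneg ht0.le]; field_simp
  rw [h3, h4, inner_smul_left, inner_smul_left, h1, h2] at ht
  have h5 : 0 < t * c := mul_pos ht0 hcpos
  refine ht.2.2 ?_ (ht.1.1 ?_) <;> simp only [RCLike.conj_to_real] <;> linarith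

theorem outwardNormal_eq {Ω : Set R3} {x ν : R3} (h : IsOutwardNormal Ω x ν) :
    outwardNormal Ω x = ν := by
  have hex : ∃ ν, IsOutwardNormal Ω x ν := ⟨ν, h⟩
  rw [outwardNormal, dif_pos hex]
  exact hex.choose_spec.unique h

theorem norm_outwardNormal_le (Ω : Set R3) (x : R3) : ‖outwardNormal Ω x‖ ≤ 1 := by
  rw [outwardNormal]
  split_ifs with h
  · exact h.choose_spec.1.le
  · simp

theorem isOutwardNormal_of_eventually_mem_iff {Ω : Set R3} {x ν : R3} (hν : ‖ν‖ = 1)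
    (h : ∀ᶠ y in 𝓝 x, (y ∈ Ω ↔ inner ℝ (y - x) ν < 0)) : IsOutwardNormal Ω x ν := by
  refine ⟨hν, fun ε hε => ?_⟩
  filter_upwards [h] with y hy
  have h0 : 0 ≤ ε * ‖y - x‖ := by positivity
  exact ⟨fun h1 => hy.2 (by linarith), fun h1 h2 => by linarith [hy.1 h2]⟩

namespace MeshPair

variable {D : SplitDomain} (M : MeshPair D) {i : Fin 2} {s : Finset R3}

/-- The vector ν is the normalised negative gradient of the coordinate. The gradient is nonzero
because the coordinate takes the values 0 and 1 at vertices. Thus ν is the outward normal on the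
face opposite to v. -/
theorem exists_unit_coord_sub (hs : s ∈ M.elements i) (v : s) : ∃ ν : R3, ‖ν‖ = 1 ∧ ∃ c : ℝ,
    0 < c ∧ ∀ x y, (M.basis hs).coord v y - (M.basis hs).coord v x = -(c * inner ℝ (y - x) ν) := by
  let ℓ : R3 →L[ℝ] ℝ := ((M.basis hs).coord v).linear.toContinuousLinearMap
  let g : R3 := (InnerProductSpace.toDual ℝ R3).symm ℓ
  have hg : ∀ x y, (M.basis hs).coord v y - (M.basis hs).coord v x = inner ℝ g (y - x) := by
    intro x y
    rw [InnerProductSpace.toDual_symm_apply]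
    exact (((M.basis hs).coord v).linearMap_vsub y x).symm
  have hg0 : g ≠ 0 := by
    intro h0
    have hcard : 1 < Fintype.card s := by
      rw [Fintype.card_coe, hs.2]; norm_num
    have : Nontrivial s := Fintype.one_lt_card_iff_nontrivial.1 hcard
    obtain ⟨w, hw⟩ := exists_ne v
    have h1 := hg (M.basis hs w) (M.basis hs v)
    rw [(M.basis hs).coord_apply_eq, (M.basis hs).coord_apply_ne hw.symm, h0, inner_zero_left] at h1
    norm_num at h1
  have hgn : 0 < ‖g‖ := norm_pos_iff.2 hg0
  refine ⟨-(‖g‖⁻¹ • g), ?_, ‖g‖, hgn, fun x y => ?_⟩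
  · rw [norm_neg, norm_smul, norm_inv, norm_norm, inv_mul_cancel₀ hgn.ne']
  · rw [hg, inner_neg_right, inner_smul_right, real_inner_comm]
    field_simp

theorem coord_of_mem_face [DecidableEq R3] (hs : s ∈ M.elements i) (v : s) {x : R3}
    (hx : x ∈ cell (s.erase v)) (hΩ : x ∉ D.Ω i) (he : x ∉ M.edges i) :
    (M.basis hs).coord v x = 0 ∧ ∀ w, w ≠ v → 0 < (M.basis hs).coord w x := by
  have h0 : (M.basis hs).coord v x = 0 :=
    M.coord_eq_zero_of_mem_convexHull hs v 
      (t := ((s.erase (v : R3) : Finset R3) : Set R3))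
      (Finset.coe_subset.2 (s.erase_subset (v : R3))) (by simp) hx
  obtain ⟨v', -, hpos⟩ := M.exists_coord_eq_zero hs (cell_erase_subset s v hx) hΩ he
  have : v = v' := by
    by_contra h
    exact (hpos v h).ne' h0
  exact ⟨h0, this ▸ hpos⟩

theorem exists_outwardNormal_eq [DecidableEq R3] (hs : s ∈ M.elements i) {v : R3} (hv : v ∈ s) :
    ∃ ν : R3, ∀ x ∈ cell (s.erase v), x ∉ D.Ω i → x ∉ M.edges i →
      outwardNormal (D.Ω i) x = ν := by
  obtain ⟨ν, hν, c, hc, hcoord⟩ := M.exists_unit_coord_sub hs ⟨v, hv⟩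
  refine ⟨ν, fun x hx hΩ he => outwardNormal_eq (isOutwardNormal_of_eventually_mem_iff hν ?_)⟩
  obtain ⟨h0, hpos⟩ := M.coord_of_mem_face hs ⟨v, hv⟩ hx hΩ he
  filter_upwards [M.eventually_mem_iff_mem_interior_cell hs (cell_erase_subset s v hx) hΩ he,
    M.eventually_mem_cell_iff hs hpos] with y hy1 hy2
  have h1 := hcoord x y
  rw [h0, sub_zero] at h1
  rw [hy1, hy2.2, h1, neg_pos, mul_neg_iff]
  constructor
  · rintro (h | h)
    · exact h.2
    · linarith [h.1]
  · exact fun h => Or.inl ⟨hc, h⟩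

theorem mem_closure_of_mem_cell (hs : s ∈ M.elements i) {x : R3} (hx : x ∈ cell s) :
    (𝓝[D.Ω i] x).NeBot :=
  mem_closure_iff_nhdsWithin_neBot.1 (M.cell_subset_closure hs hx)

end MeshPair

/-! ### Gradients, conjugation, and essentially bounded functions on the interface. -/

theorem fderiv_eq_sum_partialDeriv (p : R3 → ℂ) (x w : R3) :
    fderiv ℝ p x w = ∑ j, (w j : ℂ) * partialDeriv p j x := by
  have hw : w = ∑ j, w j • EuclideanSpace.single j (1 : ℝ) := by
    simpa using ((EuclideanSpace.basisFun (Fin 3) ℝ).sum_repr w).symm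
  conv_lhs => rw [hw]
  simp [partialDeriv]

theorem sq_norm_fderiv_le (p : R3 → ℂ) (x w : R3) :
    ‖fderiv ℝ p x w‖ ^ 2 ≤ ‖w‖ ^ 2 * gradSq p x := by
  rw [fderiv_eq_sum_partialDeriv, EuclideanSpace.norm_sq_eq, gradSq]
  refine le_trans ?_ (Finset.sum_mul_sq_le_sq_mul_sq _ _ _)
  gcongr
  refine (norm_sum_le _ _).trans_eq ?_
  simp

theorem fderiv_conj (p : R3 → ℂ) (x w : R3) :
    fderiv ℝ (fun x => (starRingEnd ℂ) (p x)) x w = (starRingEnd ℂ) (fderiv ℝ p x w) := by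
  have h : fderiv ℝ (fun x => (starRingEnd ℂ) (p x)) x =
      (Complex.conjCLE : ℂ ≃L[ℝ] ℂ).toContinuousLinearMap.comp (fderiv ℝ p x) :=
    (Complex.conjCLE : ℂ ≃L[ℝ] ℂ).comp_fderiv
  rw [h]; simp

theorem gradSq_nonneg (p : R3 → ℂ) (x : R3) : 0 ≤ gradSq p x :=
  Finset.sum_nonneg fun _ _ => by positivity

theorem gradDot_conj (p : R3 → ℂ) (x : R3) :
    gradDot p (fun x => (starRingEnd ℂ) (p x)) x = (gradSq p x : ℂ) := by
  simp only [gradDot, gradSq, partialDeriv, fderiv_conj, Complex.mul_conj']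
  push_cast; rfl

theorem gradSq_polyFun (P : MvPolynomial (Fin 3) ℂ) (x : R3) :
    gradSq (polyFun P) x = ∑ j, ‖polyFun (MvPolynomial.pderiv j P) x‖ ^ 2 := by
  simp only [gradSq, partialDeriv_polyFun]

theorem continuous_gradSq_polyFun (P : MvPolynomial (Fin 3) ℂ) :
    Continuous (gradSq (polyFun P)) := by
  have : gradSq (polyFun P) = fun x => ∑ j, ‖polyFun (MvPolynomial.pderiv j P) x‖ ^ 2 :=
    funext (gradSq_polyFun P)
  rw [this]
  exact continuous_finsetSum _ fun j _ => (continuous_polyFun _).norm.pow 2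

namespace SplitDomain

variable (D : SplitDomain)

theorem ΓI_subset_frontier (i : Fin 2) : D.ΓI ⊆ frontier (D.Ω i) := by
  intro x hx
  rw [(D.isOpen i).frontier_eq]
  have h0 := D.disjoint.closure_right (D.isOpen 0)
  have h1 := D.disjoint.closure_left (D.isOpen 1)
  fin_cases i
  · exact ⟨hx.1, fun h => Set.disjoint_left.1 h0 h hx.2⟩
  · exact ⟨hx.2, fun h => Set.disjoint_left.1 h1 hx.1 h⟩

theorem notMem_of_mem_ΓI {x : R3} (hx : x ∈ D.ΓI) (i : Fin 2) : x ∉ D.Ω i := by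
  have h := D.ΓI_subset_frontier i hx
  rw [(D.isOpen i).frontier_eq] at h
  exact h.2

theorem isCompact_ΓI : IsCompact D.ΓI :=
  (D.isBounded 0).isCompact_closure.inter_right isClosed_closure

theorem measurableSet_ΓI : MeasurableSet D.ΓI := D.isCompact_ΓI.measurableSet

/-- The surface measure on the interface. -/
abbrev interfaceMeasure : Measure R3 := surfaceMeasure.restrict D.ΓI

theorem ae_norm_n_le : ∀ᵐ x ∂D.interfaceMeasure, ‖D.n x‖ ≤ 1 := by
  filter_upwards [D.n_eq] with x hx
  rcases hx with hx | hx <;> rw [hx] <;> exact norm_outwardNormal_le _ _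

theorem memLp_n_apply (j : Fin 3) : MemLp (fun x => ((D.n x j : ℝ) : ℂ)) ⊤ D.interfaceMeasure := by
  refine memLp_top_of_bound ?_ 1 ?_
  · exact Complex.continuous_ofReal.comp_aestronglyMeasurable
      ((EuclideanSpace.proj (𝕜 := ℝ) j).continuous.comp_aestronglyMeasurable
        D.n_aestronglyMeasurable)
  · filter_upwards [D.ae_norm_n_le] with x hx
    rw [Complex.norm_real]
    exact (PiLp.norm_apply_le (D.n x) j).trans hx

end SplitDomain

theorem MeasureTheory.MemLp.exists_ae_norm_le {α E : Type*} [MeasurableSpace α]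
    [NormedAddCommGroup E] {μ : Measure α} {f : α → E} (hf : MemLp f ⊤ μ) :
    ∃ C : ℝ, ∀ᵐ x ∂μ, ‖f x‖ ≤ C := by
  have h := hf.2
  rw [eLpNorm_exponent_top, eLpNormEssSup_lt_top_iff_isBoundedUnder] at h
  obtain ⟨C, hC⟩ := h
  rw [Filter.eventually_map] at hC
  exact ⟨C, hC.mono fun x hx => hx⟩

theorem memLp_top_iUnion {α E ι : Type*} [MeasurableSpace α] [NormedAddCommGroup E] [Finite ι]
    {μ : Measure α} {f : α → E} {t : ι → Set α} (h : ∀ j, MemLp f ⊤ (μ.restrict (t j))) :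
    MemLp f ⊤ (μ.restrict (⋃ j, t j)) := by
  choose C hC using fun j => (h j).exists_ae_norm_le
  obtain ⟨B, hB⟩ := (Set.finite_range C).bddAbove
  refine memLp_top_of_bound ((aestronglyMeasurable_iUnion_iff).2 fun j => (h j).1) B ?_
  rw [ae_restrict_iUnion_iff]
  intro j
  filter_upwards [hC j] with x hx
  exact hx.trans (hB ⟨j, rfl⟩)

/-! ### Traces, fluxes and jumps of finite element functions. -/

namespace MeshPair

variable {D : SplitDomain} (M : MeshPair D) {i : Fin 2} {s : Finset R3}

theorem ae_notMem_edges (i : Fin 2) (t : Set R3) :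
    ∀ᵐ x ∂(surfaceMeasure.restrict t), x ∉ M.edges i :=
  ae_restrict_of_ae (measure_eq_zero_iff_ae_notMem.1 (M.surfaceMeasure_edges i))

/-- Finitely many triangles and a null set of edges cover the interface. Consequently essentially
bounded functions are integrable there. -/
theorem isFiniteMeasure_interfaceMeasure (M : MeshPair D) : IsFiniteMeasure D.interfaceMeasure := by
  classical
  obtain ⟨A, -, hA⟩ := exists_surfaceMeasure_triangle_le
  refine ⟨?_⟩
  rw [Measure.restrict_apply_univ]
  have hsub : D.ΓI ⊆ M.edges 0 ∪ ⋃ s ∈ M.elements 0, ⋃ v ∈ s, cell (s.erase v) := by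
    intro x hx
    by_cases he : x ∈ M.edges 0
    · exact Or.inl he
    obtain ⟨s, hs, v, hv, hxv⟩ := M.exists_mem_face (D.ΓI_subset_frontier 0 hx) he
    exact Or.inr (Set.mem_biUnion hs (Set.mem_biUnion hv hxv))
  refine (measure_mono hsub).trans_lt ((measure_union_le _ _).trans_lt ?_)
  rw [M.surfaceMeasure_edges, zero_add]
  refine measure_biUnion_lt_top (M.finite_elements 0) fun s hs => ?_
  refine measure_biUnion_lt_top s.finite_toSet fun v hv => ?_
  refine (hA (s.erase v) ?_ (Metric.diam (s.erase v : Set R3)) fun x hx y hy => ?_).trans_lt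
    ENNReal.ofReal_lt_top
  · rw [Finset.card_erase_of_mem hv, hs.2]
  · exact Metric.dist_le_diam_of_mem (s.erase v).finite_toSet.isBounded hx hy

/-- Limits and chosen normals carry no measurability of their own; this lemma obtains it, with
boundedness, from a good representative on each face. -/
theorem memLp_interface [DecidableEq R3] {E : Type*} [NormedAddCommGroup E] {f : R3 → E}
    (i : Fin 2)
    (h : ∀ s ∈ M.elements i, ∀ v ∈ s, ∃ g, MemLp g ⊤ D.interfaceMeasure ∧
      ∀ x ∈ D.ΓI, x ∉ M.edges i → x ∈ cell (s.erase v) → f x = g x) :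
    MemLp f ⊤ D.interfaceMeasure := by
  have := (M.finite_elements i).to_subtype
  let S : (Σ s : M.elements i, (s : Finset R3)) → Set R3 :=
    fun j => D.ΓI ∩ cell ((j.1 : Finset R3).erase j.2)
  have h1 : MemLp f ⊤ (surfaceMeasure.restrict (⋃ j, S j)) := by
    refine memLp_top_iUnion fun j => ?_
    obtain ⟨g, hg, hfg⟩ := h j.1 j.1.2 j.2 j.2.2
    refine MemLp.ae_eq (f := g) ?_ (hg.mono_measure
      (Measure.restrict_mono_set _ Set.inter_subset_left))
    have hS : MeasurableSet (S j) :=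
      D.measurableSet_ΓI.inter (isCompact_cell _).isClosed.measurableSet
    filter_upwards [ae_restrict_mem hS, M.ae_notMem_edges i (S j)] with x hx he
    exact (hfg x hx.1 he hx.2).symm
  have h2 : D.ΓI ≤ᵐ[surfaceMeasure] ⋃ j, S j := by
    filter_upwards [measure_eq_zero_iff_ae_notMem.1 (M.surfaceMeasure_edges i)] with x he hx
    obtain ⟨s, hs, v, hv, hxv⟩ := M.exists_mem_face (D.ΓI_subset_frontier i hx) he
    exact Set.mem_iUnion.2 ⟨⟨⟨s, hs⟩, ⟨v, hv⟩⟩, hx, hxv⟩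
  exact h1.mono_measure (Measure.restrict_mono_ae h2)

theorem memLp_outwardNormal (M : MeshPair D) (i : Fin 2) :
    MemLp (outwardNormal (D.Ω i)) ⊤ D.interfaceMeasure := by
  classical
  refine M.memLp_interface i fun s hs v hv => ?_
  obtain ⟨ν, hν⟩ := M.exists_outwardNormal_eq hs hv
  exact ⟨fun _ => ν, memLp_top_const ν, fun x hx he hxv =>
    hν x hxv (D.notMem_of_mem_ΓI hx i) he⟩

theorem memLp_of_continuous {g : R3 → ℂ} (hg : Continuous g) : MemLp g ⊤ D.interfaceMeasure := by
  obtain ⟨C, hC⟩ := D.isCompact_ΓI.exists_bound_of_continuousOn hg.continuousOn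
  refine memLp_top_of_bound hg.aestronglyMeasurable C ?_
  filter_upwards [ae_restrict_mem D.measurableSet_ΓI] with x hx using hC x hx

variable {k : ℕ} {p : R3 → ℂ}

theorem exists_polyFun_eq (hp : p ∈ M.feSpace k) (hs : s ∈ M.elements i) :
    ∃ P : MvPolynomial (Fin 3) ℂ, P.totalDegree ≤ k ∧
      ∀ x ∈ cell s ∩ D.Ω i, p x = polyFun P x := by
  obtain ⟨v, hv, w, hw, rfl⟩ := Submodule.mem_sup.1 hp
  have hdis := Set.disjoint_left.1 D.disjoint
  fin_cases i
  · obtain ⟨P, hP, hvP⟩ := hv.2.1 s hs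
    refine ⟨P, hP, fun x hx => ?_⟩
    rw [Pi.add_apply, hw.2.2 x (hdis hx.2), add_zero, hvP x hx]; rfl
  · obtain ⟨P, hP, hwP⟩ := hw.2.1 s hs
    refine ⟨P, hP, fun x hx => ?_⟩
    rw [Pi.add_apply, hv.2.2 x (fun h => hdis h hx.2), zero_add, hwP x hx]; rfl

theorem fderiv_eq_of_mem_interior {P : MvPolynomial (Fin 3) ℂ} (hs : s ∈ M.elements i)
    (hP : ∀ x ∈ cell s ∩ D.Ω i, p x = polyFun P x) {x : R3} (hx : x ∈ interior (cell s)) :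
    fderiv ℝ p x = fderiv ℝ (polyFun P) x := by
  refine Filter.EventuallyEq.fderiv_eq ?_
  filter_upwards [isOpen_interior.mem_nhds hx] with y hy
  exact hP y ⟨interior_subset hy, M.interior_cell_subset hs hy⟩

theorem gradSq_eq_of_mem_interior {P : MvPolynomial (Fin 3) ℂ} (hs : s ∈ M.elements i)
    (hP : ∀ x ∈ cell s ∩ D.Ω i, p x = polyFun P x) {x : R3} (hx : x ∈ interior (cell s)) :
    gradSq p x = gradSq (polyFun P) x := by
  simp only [gradSq, partialDeriv, M.fderiv_eq_of_mem_interior hs hP hx]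

section Trace

variable {P : MvPolynomial (Fin 3) ℂ} {x : R3}

theorem tendsto_of_mem_cell (hs : s ∈ M.elements i)
    (hP : ∀ x ∈ cell s ∩ D.Ω i, p x = polyFun P x) (hx : x ∈ cell s) (hΩ : x ∉ D.Ω i)
    (he : x ∉ M.edges i) : Filter.Tendsto p (𝓝[D.Ω i] x) (𝓝 (polyFun P x)) := by
  refine (((continuous_polyFun P).tendsto x).mono_left nhdsWithin_le_nhds).congr' ?_
  filter_upwards [nhdsWithin_le_nhds (M.eventually_mem_iff_mem_interior_cell hs hx hΩ he),
    self_mem_nhdsWithin] with y hy hyΩ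
  exact (hP y ⟨interior_subset (hy.1 hyΩ), hyΩ⟩).symm

theorem tendsto_fderiv_of_mem_cell (hs : s ∈ M.elements i)
    (hP : ∀ x ∈ cell s ∩ D.Ω i, p x = polyFun P x) (hx : x ∈ cell s) (hΩ : x ∉ D.Ω i)
    (he : x ∉ M.edges i) (w : R3) :
    Filter.Tendsto (fun y => fderiv ℝ p y w) (𝓝[D.Ω i] x) (𝓝 (fderiv ℝ (polyFun P) x w)) := by
  have hcont : Continuous fun y => fderiv ℝ (polyFun P) y w :=
    ((contDiff_polyFun P 1).continuous_fderiv one_ne_zero).clm_apply continuous_const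
  refine ((hcont.tendsto x).mono_left nhdsWithin_le_nhds).congr' ?_
  filter_upwards [nhdsWithin_le_nhds (M.eventually_mem_iff_mem_interior_cell hs hx hΩ he),
    self_mem_nhdsWithin] with y hy hyΩ
  rw [M.fderiv_eq_of_mem_interior hs hP (hy.1 hyΩ)]

theorem trace_eq (hs : s ∈ M.elements i)
    (hP : ∀ x ∈ cell s ∩ D.Ω i, p x = polyFun P x) (hx : x ∈ cell s) (hΩ : x ∉ D.Ω i)
    (he : x ∉ M.edges i) : D.trace i p x = polyFun P x :=
  have := M.mem_closure_of_mem_cell hs hx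
  (M.tendsto_of_mem_cell hs hP hx hΩ he).limUnder_eq

theorem normalDeriv_eq (hs : s ∈ M.elements i)
    (hP : ∀ x ∈ cell s ∩ D.Ω i, p x = polyFun P x) (hx : x ∈ cell s) (hΩ : x ∉ D.Ω i)
    (he : x ∉ M.edges i) : D.normalDeriv i p x = fderiv ℝ (polyFun P) x (D.n x) :=
  have := M.mem_closure_of_mem_cell hs hx
  (M.tendsto_fderiv_of_mem_cell hs hP hx hΩ he (D.n x)).limUnder_eq

theorem trace_conj (hp : p ∈ M.feSpace k) (hx : x ∈ frontier (D.Ω i)) (he : x ∉ M.edges i) :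
    D.trace i (fun x => (starRingEnd ℂ) (p x)) x = (starRingEnd ℂ) (D.trace i p x) := by
  classical
  obtain ⟨s, hs, v, -, hxv⟩ := M.exists_mem_face hx he
  obtain ⟨P, -, hP⟩ := M.exists_polyFun_eq hp hs
  rw [(D.isOpen i).frontier_eq] at hx
  have hxs := cell_erase_subset s v hxv
  have := M.mem_closure_of_mem_cell hs hxs
  rw [M.trace_eq hs hP hxs hx.2 he]
  exact ((Complex.continuous_conj.tendsto _).comp
    (M.tendsto_of_mem_cell hs hP hxs hx.2 he)).limUnder_eq

theorem normalDeriv_conj (hp : p ∈ M.feSpace k) (hx : x ∈ frontier (D.Ω i))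
    (he : x ∉ M.edges i) :
    D.normalDeriv i (fun x => (starRingEnd ℂ) (p x)) x =
      (starRingEnd ℂ) (D.normalDeriv i p x) := by
  classical
  obtain ⟨s, hs, v, -, hxv⟩ := M.exists_mem_face hx he
  obtain ⟨P, -, hP⟩ := M.exists_polyFun_eq hp hs
  rw [(D.isOpen i).frontier_eq] at hx
  have hxs := cell_erase_subset s v hxv
  have := M.mem_closure_of_mem_cell hs hxs
  rw [M.normalDeriv_eq hs hP hxs hx.2 he]
  refine Filter.Tendsto.limUnder_eq ?_
  simp only [fderiv_conj]
  exact (Complex.continuous_conj.tendsto _).comp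
    (M.tendsto_fderiv_of_mem_cell hs hP hxs hx.2 he (D.n x))

end Trace

theorem memLp_trace (hp : p ∈ M.feSpace k) (i : Fin 2) :
    MemLp (D.trace i p) ⊤ D.interfaceMeasure := by
  classical
  refine M.memLp_interface i fun s hs v hv => ?_
  obtain ⟨P, -, hP⟩ := M.exists_polyFun_eq hp hs
  exact ⟨polyFun P, memLp_of_continuous (continuous_polyFun P), fun x hx he hxv =>
    M.trace_eq hs hP (cell_erase_subset s v hxv) (D.notMem_of_mem_ΓI hx i) he⟩

theorem memLp_normalDeriv (hp : p ∈ M.feSpace k) (i : Fin 2) :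
    MemLp (D.normalDeriv i p) ⊤ D.interfaceMeasure := by
  classical
  refine M.memLp_interface i fun s hs v hv => ?_
  obtain ⟨P, -, hP⟩ := M.exists_polyFun_eq hp hs
  refine ⟨fun x => ∑ j, (D.n x j : ℂ) * polyFun (MvPolynomial.pderiv j P) x,
    memLp_finsetSum _ fun j _ => ?_, fun x hx he hxv => ?_⟩
  · exact (memLp_of_continuous (continuous_polyFun _)).mul (D.memLp_n_apply j)
  · rw [M.normalDeriv_eq hs hP (cell_erase_subset s v hxv) (D.notMem_of_mem_ΓI hx i) he,
      fderiv_eq_sum_partialDeriv]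
    simp only [partialDeriv_polyFun]

theorem memLp_avgFlux (hp : p ∈ M.feSpace k) : MemLp (D.avgFlux p) ⊤ D.interfaceMeasure :=
  ((M.memLp_normalDeriv hp 0).add (M.memLp_normalDeriv hp 1)).const_mul (1 / 2 : ℂ)

theorem memLp_jump (hp : p ∈ M.feSpace k) : MemLp (D.jump p) ⊤ D.interfaceMeasure := by
  refine memLp_finsetSum _ fun i _ => ?_
  refine (M.memLp_trace hp i).mul (p := ⊤) (memLp_top_of_bound ?_ 1 ?_)
  · exact Complex.continuous_ofReal.comp_aestronglyMeasurable
      (D.n_aestronglyMeasurable.inner (M.memLp_outwardNormal i).1)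
  · filter_upwards [D.ae_norm_n_le] with x hx
    rw [Complex.norm_real]
    refine (norm_inner_le_norm _ _).trans ?_
    exact mul_le_one₀ hx (norm_nonneg _) (norm_outwardNormal_le _ _)

theorem ae_avgFlux_conj (hp : p ∈ M.feSpace k) : ∀ᵐ x ∂D.interfaceMeasure,
    D.avgFlux (fun x => (starRingEnd ℂ) (p x)) x = (starRingEnd ℂ) (D.avgFlux p x) := by
  filter_upwards [ae_restrict_mem D.measurableSet_ΓI, M.ae_notMem_edges 0 D.ΓI,
    M.ae_notMem_edges 1 D.ΓI] with x hx h0 h1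
  simp only [SplitDomain.avgFlux, M.normalDeriv_conj hp (D.ΓI_subset_frontier 0 hx) h0,
    M.normalDeriv_conj hp (D.ΓI_subset_frontier 1 hx) h1]
  simp [Complex.conj_ofNat]

theorem ae_jump_conj (hp : p ∈ M.feSpace k) : ∀ᵐ x ∂D.interfaceMeasure,
    D.jump (fun x => (starRingEnd ℂ) (p x)) x = (starRingEnd ℂ) (D.jump p x) := by
  filter_upwards [ae_restrict_mem D.measurableSet_ΓI, M.ae_notMem_edges 0 D.ΓI,
    M.ae_notMem_edges 1 D.ΓI] with x hx h0 h1
  simp only [SplitDomain.jump, Fin.sum_univ_two,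
    M.trace_conj hp (D.ΓI_subset_frontier 0 hx) h0,
    M.trace_conj hp (D.ΓI_subset_frontier 1 hx) h1]
  simp

end MeshPair

/-! ### The inverse inequality. -/

namespace MeshPair

variable {D : SplitDomain} (M : MeshPair D) {i : Fin 2} {s : Finset R3}

theorem diam_cell_pos (hs : s ∈ M.elements i) : 0 < Metric.diam (cell s) := by
  obtain ⟨a, ha, b, hb, hab⟩ := Finset.one_lt_card.1 (show 1 < s.card by rw [hs.2]; norm_num)
  exact (dist_pos.2 hab).trans_le (Metric.dist_le_diam_of_mem (isCompact_cell s).isBounded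
    (subset_convexHull ℝ _ ha) (subset_convexHull ℝ _ hb))

theorem diam_cell_le_meshSize (hs : s ∈ M.elements i) : Metric.diam (cell s) ≤ M.meshSize := by
  refine le_csSup (Set.Finite.bddAbove ?_) ⟨i, s, hs, rfl⟩
  have : {d : ℝ | ∃ i, ∃ s ∈ M.elements i, d = Metric.diam (cell s)} =
      ⋃ i, (fun s => Metric.diam (cell s)) '' M.elements i := by
    ext d
    simp only [Set.mem_ofPred_eq, Set.mem_iUnion, Set.mem_image, eq_comm]
  rw [this]
  exact Set.finite_iUnion fun i => (M.finite_elements i).image _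

theorem elements_nonempty (i : Fin 2) : (M.elements i).Nonempty := by
  obtain ⟨x, hx⟩ := (D.isConnected i).nonempty
  have hxc := subset_closure hx
  rw [M.closure_eq_biUnion_cell] at hxc
  obtain ⟨s, hs, -⟩ := Set.mem_iUnion₂.1 hxc
  exact ⟨s, hs⟩

theorem meshSize_pos : 0 < M.meshSize := by
  obtain ⟨s, hs⟩ := M.elements_nonempty 0
  exact (M.diam_cell_pos hs).trans_le (M.diam_cell_le_meshSize hs)

theorem exists_closedBall_subset {σ : ℝ} (hσ : M.NonDegenerate σ) (hs : s ∈ M.elements i) :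
    ∃ (c : R3) (r : ℝ), 0 < r ∧ Metric.closedBall c r ⊆ cell s ∧
      Metric.diam (cell s) ≤ 4 * σ * r := by
  have hh := M.diam_cell_pos hs
  have h1 := hσ i s hs
  have hρ0 : 0 ≤ ballDiam (cell s) := Real.sSup_nonneg fun d hd => hd.1
  have hσρ : 0 < σ * ballDiam (cell s) := hh.trans_le h1
  have hσ0 : 0 < σ := by
    by_contra h
    nlinarith
  have hρ : 0 < ballDiam (cell s) := (pos_iff_pos_of_mul_pos hσρ).1 hσ0
  -- A ball of diameter d > ρ_K/2 avoids showing that the supremum is attained. With r = d/2 it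
  -- gives h_K ≤ σρ_K ≤ 2σd = 4σr.
  obtain ⟨d, ⟨-, c, hc⟩, hd⟩ := exists_lt_of_lt_csSup (Set.nonempty_iff_ne_empty.2 fun h => by
    rw [ballDiam, h, Real.sSup_empty] at hρ; exact lt_irrefl _ hρ) (half_lt_self hρ)
  change ballDiam (cell s) / 2 < d at hd
  refine ⟨c, d / 2, by linarith, hc, h1.trans ?_⟩
  have : ballDiam (cell s) < 2 * d := by linarith
  nlinarith

variable {k : ℕ} {p : R3 → ℂ}

theorem integrableOn_gradSq_cell (hp : p ∈ M.feSpace k) (hs : s ∈ M.elements i) :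
    IntegrableOn (gradSq p) (cell s) := by
  obtain ⟨P, -, hP⟩ := M.exists_polyFun_eq hp hs
  have h1 : IntegrableOn (gradSq (polyFun P)) (interior (cell s)) :=
    ((continuous_gradSq_polyFun P).continuousOn.integrableOn_compact (isCompact_cell s)).mono_set
      interior_subset
  have h2 : IntegrableOn (gradSq p) (interior (cell s)) :=
    h1.congr_fun (fun x hx => (M.gradSq_eq_of_mem_interior hs hP hx).symm)
      isOpen_interior.measurableSet
  -- The derivative is identified with that of a polynomial only in the interior, and the frontier
  -- of a convex set is null.
  exact h2.congr_set_ae (interior_ae_eq_of_null_frontier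
    ((convex_convexHull ℝ _).addHaar_frontier volume)).symm

theorem integrableOn_gradSq (hp : p ∈ M.feSpace k) (i : Fin 2) :
    IntegrableOn (gradSq p) (D.Ω i) := by
  refine IntegrableOn.mono_set ?_ (subset_closure (s := D.Ω i))
  rw [M.closure_eq_biUnion_cell, integrableOn_finite_biUnion (M.finite_elements i)]
  exact fun s hs => M.integrableOn_gradSq_cell hp hs

theorem sum_integral_interior_cell_le (hp : p ∈ M.feSpace k) (i : Fin 2) :
    ∑ s ∈ (M.finite_elements i).toFinset, ∫ x in interior (cell s), gradSq p x ≤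
      ∫ x in D.Ω i, gradSq p x := by
  have hmem : ∀ s ∈ (M.finite_elements i).toFinset, s ∈ M.elements i := fun s hs =>
    (M.finite_elements i).mem_toFinset.1 hs
  rw [← integral_biUnion_finset _ (fun s _ => isOpen_interior.measurableSet)
    (fun s hs t ht hst => M.disjoint_interior_cell (hmem s hs) (hmem t ht) hst)
    (fun s hs => (M.integrableOn_gradSq_cell hp (hmem s hs)).mono_set interior_subset)]
  have hsub : (⋃ s ∈ (M.finite_elements i).toFinset, interior (cell s)) ⊆ D.Ω i :=
    Set.iUnion₂_subset fun s hs => M.interior_cell_subset (hmem s hs)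
  exact setIntegral_mono_set (M.integrableOn_gradSq hp i)
    (Filter.Eventually.of_forall fun x => gradSq_nonneg p x) hsub.eventuallyLE

theorem integral_gradSq_union (hp : p ∈ M.feSpace k) :
    ∫ x in D.Ω 0 ∪ D.Ω 1, gradSq p x = ∑ i, ∫ x in D.Ω i, gradSq p x := by
  rw [setIntegral_union D.disjoint (D.isOpen 1).measurableSet (M.integrableOn_gradSq hp 0)
    (M.integrableOn_gradSq hp 1), Fin.sum_univ_two]

/-- The element lies in the concentric ball of radius 4σr around its inscribed ball of radius r, so
the polynomial estimate applies to each partial derivative. -/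
theorem gradSq_polyFun_mul_diam_le {σ C : ℝ} (hp : p ∈ M.feSpace k) (hC0 : 0 ≤ C)
    (hC : ∀ P : MvPolynomial (Fin 3) ℂ, P.totalDegree ≤ k → ∀ (c : R3) (r : ℝ), 0 < r →
      ∀ x ∈ Metric.closedBall c (4 * σ * r),
        ‖polyFun P x‖ ^ 2 * r ^ 3 ≤ C * ∫ y in Metric.ball c r, ‖polyFun P y‖ ^ 2)
    (hσ : M.NonDegenerate σ) (hs : s ∈ M.elements i) {P : MvPolynomial (Fin 3) ℂ}
    (hPk : P.totalDegree ≤ k) (hP : ∀ x ∈ cell s ∩ D.Ω i, p x = polyFun P x)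
    {x : R3} (hx : x ∈ cell s) :
    gradSq (polyFun P) x * Metric.diam (cell s) ^ 3 ≤
      (4 * σ) ^ 3 * C * ∫ y in interior (cell s), gradSq p y := by
  obtain ⟨c, r, hr, hball, hdiam⟩ := M.exists_closedBall_subset hσ hs
  have hxc : x ∈ Metric.closedBall c (4 * σ * r) := by
    refine Metric.mem_closedBall.2 (le_trans ?_ hdiam)
    exact Metric.dist_le_diam_of_mem (isCompact_cell s).isBounded hx
      (hball (Metric.mem_closedBall_self hr.le))
  have hσ0 : 0 < 4 * σ := by
    by_contra h
    nlinarith [M.diam_cell_pos hs]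
  have hint : ∀ Q : MvPolynomial (Fin 3) ℂ,
      IntegrableOn (fun y => ‖polyFun Q y‖ ^ 2) (Metric.ball c r) := fun Q =>
    (((continuous_polyFun Q).norm.pow 2).continuousOn.integrableOn_compact
      (isCompact_closedBall c r)).mono_set Metric.ball_subset_closedBall
  have h1 : gradSq (polyFun P) x * r ^ 3 ≤ C * ∫ y in Metric.ball c r, gradSq (polyFun P) y := by
    simp only [gradSq_polyFun]
    rw [integral_finsetSum _ fun j _ => hint _, Finset.sum_mul, Finset.mul_sum]
    exact Finset.sum_le_sum fun j _ =>
      hC _ ((totalDegree_pderiv_le P j).trans hPk) c r hr x hxc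
  have hsub : Metric.ball c r ⊆ interior (cell s) :=
    interior_maximal (Metric.ball_subset_closedBall.trans hball) Metric.isOpen_ball
  have h2 : ∫ y in Metric.ball c r, gradSq (polyFun P) y ≤
      ∫ y in interior (cell s), gradSq p y := by
    rw [setIntegral_congr_fun Metric.isOpen_ball.measurableSet fun y hy =>
      (M.gradSq_eq_of_mem_interior hs hP (hsub hy)).symm]
    exact setIntegral_mono_set ((M.integrableOn_gradSq_cell hp hs).mono_set interior_subset)
      (Filter.Eventually.of_forall fun x => gradSq_nonneg p x) hsub.eventuallyLE
  have h3 := h1.trans (mul_le_mul_of_nonneg_left h2 hC0)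
  calc gradSq (polyFun P) x * Metric.diam (cell s) ^ 3
      ≤ gradSq (polyFun P) x * (4 * σ * r) ^ 3 := by
        have := gradSq_nonneg (polyFun P) x
        have := (M.diam_cell_pos hs).le
        gcongr
    _ = (4 * σ) ^ 3 * (gradSq (polyFun P) x * r ^ 3) := by ring
    _ ≤ (4 * σ) ^ 3 * (C * ∫ y in interior (cell s), gradSq p y) := by
        exact mul_le_mul_of_nonneg_left h3 (by positivity)
    _ = _ := by ring

/-- Per face, h · area · sup|∇p|² is at most (τh_K)(Ah_K²)(I/h_K³), and the powers of h_K cancel.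
Four faces per element and the factor 1/2 from averaging two fluxes give 2τA. -/
theorem inverseInequality_of_bounds [DecidableEq R3] {A C σ τ : ℝ} (hA0 : 0 ≤ A) (hC0 : 0 ≤ C)
    (hA : ∀ (t : Finset R3), t.card = 3 → ∀ d : ℝ, (∀ x ∈ t, ∀ y ∈ t, dist x y ≤ d) →
      surfaceMeasure (cell t) ≤ ENNReal.ofReal (A * d ^ 2))
    (hC : ∀ P : MvPolynomial (Fin 3) ℂ, P.totalDegree ≤ k → ∀ (c : R3) (r : ℝ), 0 < r →
      ∀ x ∈ Metric.closedBall c (4 * σ * r),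
        ‖polyFun P x‖ ^ 2 * r ^ 3 ≤ C * ∫ y in Metric.ball c r, ‖polyFun P y‖ ^ 2)
    (hσ : M.NonDegenerate σ) (hτ : M.QuasiUniform τ) :
    M.InverseInequality k (2 * τ * A * ((4 * σ) ^ 3 * C)) := by
  intro p hp
  have := M.isFiniteMeasure_interfaceMeasure
  set h := M.meshSize with hh
  have hpos : 0 < h := M.meshSize_pos
  let E : Fin 2 → Finset (Finset R3) := fun i => (M.finite_elements i).toFinset
  have hE : ∀ i s, s ∈ E i → s ∈ M.elements i := fun i s hs =>
    (M.finite_elements i).mem_toFinset.1 hs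
  let I : Finset R3 → ℝ := fun s => (4 * σ) ^ 3 * C * ∫ y in interior (cell s), gradSq p y
  let B : Finset R3 → ℝ := fun s => I s / Metric.diam (cell s) ^ 3
  have hB : ∀ i, ∀ s ∈ M.elements i, 0 ≤ B s ∧ ∀ P : MvPolynomial (Fin 3) ℂ,
      P.totalDegree ≤ k → (∀ x ∈ cell s ∩ D.Ω i, p x = polyFun P x) →
      ∀ x ∈ cell s, gradSq (polyFun P) x ≤ B s := by
    intro i s hs
    have hd : 0 < Metric.diam (cell s) ^ 3 := pow_pos (M.diam_cell_pos hs) 3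
    have key : ∀ P : MvPolynomial (Fin 3) ℂ,
        P.totalDegree ≤ k → (∀ x ∈ cell s ∩ D.Ω i, p x = polyFun P x) →
        ∀ x ∈ cell s, gradSq (polyFun P) x ≤ B s := fun P hPk hP x hx =>
      (le_div_iff₀ hd).2 (M.gradSq_polyFun_mul_diam_le hp hC0 hC hσ hs hPk hP hx)
    obtain ⟨P, hPk, hP⟩ := M.exists_polyFun_eq hp hs
    obtain ⟨y, hy⟩ := M.interior_cell_nonempty hs
    exact ⟨(gradSq_nonneg _ y).trans (key P hPk hP y (interior_subset hy)), key⟩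
  -- Summing over all faces, including those off the interface, gives an integrable majorant of the
  -- squared flux without decomposing the interface.
  let G : Fin 2 → R3 → ℝ := fun i x =>
    ∑ s ∈ E i, ∑ v ∈ s, (cell (s.erase v)).indicator (fun _ => B s) x
  have hmeas : ∀ t : Finset R3, MeasurableSet (cell t) := fun t =>
    (isCompact_cell t).isClosed.measurableSet
  have hG : ∀ i, ∀ᵐ x ∂D.interfaceMeasure, ‖D.normalDeriv i p x‖ ^ 2 ≤ G i x := by
    intro i
    filter_upwards [ae_restrict_mem D.measurableSet_ΓI, M.ae_notMem_edges i D.ΓI,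
      D.ae_norm_n_le] with x hx he hn
    obtain ⟨s, hs, v, hv, hxv⟩ := M.exists_mem_face (D.ΓI_subset_frontier i hx) he
    obtain ⟨P, hPk, hP⟩ := M.exists_polyFun_eq hp hs
    have hxs := cell_erase_subset s v hxv
    rw [M.normalDeriv_eq hs hP hxs (D.notMem_of_mem_ΓI hx i) he]
    have h0 : ∀ s ∈ E i, ∀ v ∈ s, 0 ≤ (cell (s.erase v)).indicator (fun _ => B s) x :=
      fun s hs v _ => Set.indicator_nonneg (fun _ _ => (hB i s (hE i s hs)).1) x
    have hsE : s ∈ E i := (M.finite_elements i).mem_toFinset.2 hs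
    calc _ ≤ ‖D.n x‖ ^ 2 * gradSq (polyFun P) x := sq_norm_fderiv_le _ _ _
      _ ≤ 1 * gradSq (polyFun P) x := by
          have := gradSq_nonneg (polyFun P) x
          gcongr
          exact pow_le_one₀ (norm_nonneg _) hn
      _ ≤ (cell (s.erase v)).indicator (fun _ => B s) x := by
          rw [one_mul, Set.indicator_of_mem hxv]
          exact (hB i s hs).2 P hPk hP x hxs
      _ ≤ ∑ v ∈ s, (cell (s.erase v)).indicator (fun _ => B s) x :=
          Finset.single_le_sum (h0 s hsE) hv
      _ ≤ _ := Finset.single_le_sum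
          (f := fun s => ∑ v ∈ s, (cell (s.erase v)).indicator (fun _ => B s) x)
          (fun s hs => Finset.sum_nonneg (h0 s hs)) hsE
  have hGint' : ∀ i, ∀ s ∈ E i, ∀ v ∈ s, Integrable
      (fun x => (cell (s.erase v)).indicator (fun _ => B s) x) D.interfaceMeasure :=
    fun i s _ v _ => (integrable_const (B s)).indicator (hmeas _)
  have hGint : ∀ i, Integrable (G i) D.interfaceMeasure := fun i =>
    integrable_finsetSum _ fun s hs => integrable_finsetSum _ fun v hv => hGint' i s hs v hv
  have hface : ∀ i, ∀ s ∈ E i, ∀ v ∈ s,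
      h * ∫ x, (cell (s.erase v)).indicator (fun _ => B s) x ∂D.interfaceMeasure ≤
        τ * A * I s := by
    intro i s hs v hv
    have hs := hE i s hs
    have hd := M.diam_cell_pos hs
    have hBs := (hB i s hs).1
    rw [integral_indicator (hmeas _), setIntegral_const, smul_eq_mul]
    have harea : D.interfaceMeasure.real (cell (s.erase v)) ≤ A * Metric.diam (cell s) ^ 2 := by
      refine ENNReal.toReal_le_of_le_ofReal (by positivity) ?_
      refine (Measure.restrict_apply_le _ _).trans (hA _ ?_ _ fun x hx y hy => ?_)
      · rw [Finset.card_erase_of_mem hv, hs.2]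
      · exact Metric.dist_le_diam_of_mem (isCompact_cell s).isBounded
          (subset_convexHull ℝ _ (Finset.mem_of_mem_erase hx))
          (subset_convexHull ℝ _ (Finset.mem_of_mem_erase hy))
    have hI : B s * Metric.diam (cell s) ^ 3 = I s := div_mul_cancel₀ _ (pow_pos hd 3).ne'
    calc _ ≤ (τ * Metric.diam (cell s)) * (A * Metric.diam (cell s) ^ 2 * B s) := by
          gcongr
          · exact hpos.le.trans (hτ i s hs)
          · exact hτ i s hs
      _ = τ * A * (B s * Metric.diam (cell s) ^ 3) := by ring
      _ = _ := by rw [hI]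
  have hGle : ∀ i, h * ∫ x, G i x ∂D.interfaceMeasure ≤
      4 * τ * A * ((4 * σ) ^ 3 * C) * ∫ x in D.Ω i, gradSq p x := by
    intro i
    have hτA : 0 ≤ 4 * τ * A * ((4 * σ) ^ 3 * C) := by
      obtain ⟨s, hs⟩ := M.elements_nonempty i
      have hd := M.diam_cell_pos hs
      obtain ⟨c, r, hr, -, hdiam⟩ := M.exists_closedBall_subset hσ hs
      have h1 : 0 < τ := by
        by_contra hn
        nlinarith [hτ i s hs]
      have h2 : 0 < 4 * σ := by
        by_contra hn
        nlinarith
      positivity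
    calc h * ∫ x, G i x ∂D.interfaceMeasure
        = ∑ s ∈ E i, ∑ v ∈ s,
            h * ∫ x, (cell (s.erase v)).indicator (fun _ => B s) x ∂D.interfaceMeasure := by
          simp only [G]
          rw [integral_finsetSum _ fun s hs => integrable_finsetSum _ fun v hv =>
            hGint' i s hs v hv, Finset.mul_sum]
          refine Finset.sum_congr rfl fun s hs => ?_
          rw [integral_finsetSum _ fun v hv => hGint' i s hs v hv, Finset.mul_sum]
      _ ≤ ∑ s ∈ E i, ∑ v ∈ s, τ * A * I s :=
          Finset.sum_le_sum fun s hs => Finset.sum_le_sum fun v hv => hface i s hs v hv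
      _ = 4 * τ * A * ((4 * σ) ^ 3 * C) *
            ∑ s ∈ E i, ∫ y in interior (cell s), gradSq p y := by
          rw [Finset.mul_sum]
          refine Finset.sum_congr rfl fun s hs => ?_
          rw [Finset.sum_const, (hE i s hs).2, nsmul_eq_mul]
          simp only [I]
          push_cast; ring
      _ ≤ _ := by
          gcongr
          exact M.sum_integral_interior_cell_le hp i
  have hmono : ∫ x in D.ΓI, h * ‖D.avgFlux p x‖ ^ 2 ∂surfaceMeasure ≤
      ∫ x in D.ΓI, h / 2 * (G 0 x + G 1 x) ∂surfaceMeasure := by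
    refine integral_mono_of_nonneg (Filter.Eventually.of_forall fun x => by positivity)
      (((hGint 0).add (hGint 1)).const_mul _) ?_
    filter_upwards [hG 0, hG 1] with x h0 h1
    have h2 : ‖D.avgFlux p x‖ ≤ 1 / 2 * (‖D.normalDeriv 0 p x‖ + ‖D.normalDeriv 1 p x‖) := by
      rw [SplitDomain.avgFlux, norm_mul]
      norm_num
      exact norm_add_le _ _
    have h3 : ‖D.avgFlux p x‖ ^ 2 ≤ 1 / 2 * (G 0 x + G 1 x) := by
      have h4 := pow_le_pow_left₀ (norm_nonneg _) h2 2
      nlinarith [sq_nonneg (‖D.normalDeriv 0 p x‖ - ‖D.normalDeriv 1 p x‖)]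
    calc _ ≤ h * (1 / 2 * (G 0 x + G 1 x)) := by gcongr
      _ = _ := by ring
  refine hmono.trans ?_
  rw [integral_const_mul, integral_add (hGint 0) (hGint 1), M.integral_gradSq_union hp,
    Fin.sum_univ_two]
  linarith [hGle 0, hGle 1]

end MeshPair

theorem exists_inverseInequality (k : ℕ) (σ τ : ℝ) : ∃ C₀ : ℝ, 0 < C₀ ∧
    ∀ (D : SplitDomain) (M : MeshPair D), M.NonDegenerate σ → M.QuasiUniform τ →
      M.InverseInequality k C₀ := by
  classical
  obtain ⟨A, hA0, hA⟩ := exists_surfaceMeasure_triangle_le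
  obtain ⟨C, hC0, hC⟩ := exists_sq_norm_polyFun_le_ball k (4 * σ)
  -- The maximum with 1 makes the constant positive for all σ and τ, even when no mesh meets the
  -- conditions.
  refine ⟨max 1 (2 * τ * A * ((4 * σ) ^ 3 * C)), by positivity, fun D M hσ hτ p hp => ?_⟩
  refine (M.inverseInequality_of_bounds hA0 hC0 hA hC hσ hτ p hp).trans ?_
  gcongr
  · exact setIntegral_nonneg (((D.isOpen 0).union (D.isOpen 1)).measurableSet)
      fun x _ => gradSq_nonneg p x
  · exact le_max_right _ _

/-! ### Pointwise algebra and bounds for λ. -/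

section Pointwise

/-- With X = J − ηF the residual is X + wF. Expanding the λ-term as w⁻¹|X|² plus cross terms plus
w|F|², the cross terms cancel and w − 2w + z = −η remains in front of |F|². -/
theorem nitsche_interface_identity {w z J F : ℂ} {η : ℝ} (hw : w = η + z) (hw0 : w ≠ 0) :
    z * F * (starRingEnd ℂ) F - F * ((starRingEnd ℂ) J + z * (starRingEnd ℂ) F)
      - (J + z * F) * (starRingEnd ℂ) F
      + w⁻¹ * (J + z * F) * ((starRingEnd ℂ) J + z * (starRingEnd ℂ) F) =
    w⁻¹ * ((‖J - η * F‖ ^ 2 : ℝ) : ℂ) - ((η * ‖F‖ ^ 2 : ℝ) : ℂ) := by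
  push_cast
  rw [← Complex.mul_conj', ← Complex.mul_conj', map_sub, map_mul, Complex.conj_ofReal]
  have hz : z = w - η := by rw [hw]; ring
  rw [hz]
  field_simp
  ring

theorem sq_norm_le_two_mul (J F : ℂ) {η : ℝ} (hη : 0 ≤ η) :
    ‖J‖ ^ 2 ≤ 2 * ‖J - η * F‖ ^ 2 + 2 * (η * ‖F‖) ^ 2 := by
  have h1 : ‖J‖ ≤ ‖J - η * F‖ + η * ‖F‖ := by
    have := norm_add_le (J - η * F) (η * F)
    rwa [sub_add_cancel, norm_mul, Complex.norm_of_nonneg hη] at this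
  nlinarith [pow_le_pow_left₀ (norm_nonneg J) h1 2, sq_nonneg (‖J - η * F‖ - η * ‖F‖)]

theorem sq_norm_sub_le (J F : ℂ) {η : ℝ} (hη : 0 ≤ η) :
    ‖J - η * F‖ ^ 2 ≤ 3 / 2 * ‖J‖ ^ 2 + 3 * (η * ‖F‖) ^ 2 := by
  have h1 : ‖J - η * F‖ ≤ ‖J‖ + η * ‖F‖ := by
    have := norm_sub_le J (η * F)
    rwa [norm_mul, Complex.norm_of_nonneg hη] at this
  -- Young's inequality weighted so that two thirds of the bound leaves coefficient 1 for |J|² in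
  -- `quarter_le_of_im_nonneg`.
  nlinarith [pow_le_pow_left₀ (norm_nonneg _) h1 2, sq_nonneg (‖J‖ - 2 * (η * ‖F‖))]

theorem quarter_le_of_nonneg {l J F : ℂ} {η : ℝ} (hη : 0 ≤ η) (hre : 0 ≤ l.re) (him : 0 ≤ l.im)
    (hl : η * ‖l‖ ≤ 1) :
    1 / 4 * (‖l‖ * ‖J‖ ^ 2) ≤ 2 / 3 * (l.re + l.im) * ‖J - η * F‖ ^ 2 + η * ‖F‖ ^ 2 := by
  have h1 := sq_norm_le_two_mul J F hη
  have h2 : ‖l‖ ≤ l.re + l.im := by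
    have := Complex.norm_le_abs_re_add_abs_im l
    rwa [abs_of_nonneg hre, abs_of_nonneg him] at this
  have h3 : ‖l‖ * ‖J‖ ^ 2 ≤ ‖l‖ * (2 * ‖J - η * F‖ ^ 2 + 2 * (η * ‖F‖) ^ 2) := by gcongr
  have h4 : ‖l‖ * ‖J - η * F‖ ^ 2 ≤ (l.re + l.im) * ‖J - η * F‖ ^ 2 := by gcongr
  have h5 : (η * ‖l‖) * (η * ‖F‖ ^ 2) ≤ 1 * (η * ‖F‖ ^ 2) := by gcongr
  have h6 : 0 ≤ (l.re + l.im) * ‖J - η * F‖ ^ 2 := by positivity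
  have h7 : 0 ≤ η * ‖F‖ ^ 2 := by positivity
  nlinarith

/-- The terms with λ cost at most |λ||J|² + ⅔η|F|², since Re λ + Im λ ≥ −|λ| and η|λ| ≤ 1/3. The
term with B supplies 3/2 |λ||J|², so at least half of |λ||J|² survives. -/
theorem quarter_le_of_im_nonneg {l J F : ℂ} {η B : ℝ} (hη : 0 ≤ η) (him : 0 ≤ l.im)
    (hl : η * ‖l‖ ≤ 1 / 3) (hB : 3 / 2 * ‖l‖ ≤ B) :
    1 / 4 * (‖l‖ * ‖J‖ ^ 2) ≤
      2 / 3 * (l.re + l.im) * ‖J - η * F‖ ^ 2 + η * ‖F‖ ^ 2 + B * ‖J‖ ^ 2 := by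
  have h1 := sq_norm_sub_le J F hη
  have h2 : -‖l‖ ≤ l.re + l.im := by
    have := (abs_le.1 (Complex.abs_re_le_norm l)).1
    linarith
  have h3 : ‖l‖ * ‖J - η * F‖ ^ 2 ≤ ‖l‖ * (3 / 2 * ‖J‖ ^ 2 + 3 * (η * ‖F‖) ^ 2) := by gcongr
  have h4 : -‖l‖ * ‖J - η * F‖ ^ 2 ≤ (l.re + l.im) * ‖J - η * F‖ ^ 2 := by gcongr
  have h5 : (η * ‖l‖) * (η * ‖F‖ ^ 2) ≤ 1 / 3 * (η * ‖F‖ ^ 2) := by gcongr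
  have h6 : 3 / 2 * ‖l‖ * ‖J‖ ^ 2 ≤ B * ‖J‖ ^ 2 := by gcongr
  have h7 : 0 ≤ η * ‖F‖ ^ 2 := by positivity
  have h8 : 0 ≤ ‖l‖ * ‖J‖ ^ 2 := by positivity
  nlinarith

/-- The number 2/3 is a rational stand-in for 1/√2. -/
theorem two_thirds_mul_re_add_im_le_norm (z : ℂ) : 2 / 3 * (z.re + z.im) ≤ ‖z‖ := by
  have h1 : ‖z‖ ^ 2 = z.re ^ 2 + z.im ^ 2 := by rw [Complex.sq_norm, Complex.normSq_apply]; ring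
  refine abs_le_of_sq_le_sq' ?_ (norm_nonneg z) |>.2
  nlinarith [sq_nonneg (z.re - z.im)]

theorem nitscheLambda_eq (κ γ h : ℝ) (ζ : R3 → ℂ) (x : R3) : nitscheLambda κ γ h ζ x =
    (((h / γ : ℝ) : ℂ) + ζ x / (Complex.I * κ))⁻¹ := by
  rw [nitscheLambda]; push_cast; rfl

theorem re_impedance (κ : ℝ) (z : ℂ) : (z / (Complex.I * κ)).re = z.im / κ := by
  have : z / (Complex.I * κ) = (-Complex.I * z) / κ := by
    field_simp
    rw [Complex.I_sq]; ring
  rw [this, Complex.div_ofReal_re]; simp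

theorem im_impedance (κ : ℝ) (z : ℂ) : (z / (Complex.I * κ)).im = -z.re / κ := by
  have : z / (Complex.I * κ) = (-Complex.I * z) / κ := by
    field_simp
    rw [Complex.I_sq]; ring
  rw [this, Complex.div_ofReal_im]; simp

variable {κ γ h δ : ℝ} {ζ : R3 → ℂ} {x : R3}

/-- Division by iκ turns Re ζ ≥ 0 into a nonpositive imaginary part of w, and inversion flips the
sign. -/
theorem im_nitscheLambda_nonneg (hκ : 0 < κ) (hre : 0 ≤ (ζ x).re) :
    0 ≤ (nitscheLambda κ γ h ζ x).im := by
  rw [nitscheLambda_eq, Complex.inv_im, Complex.add_im, Complex.ofReal_im, zero_add,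
    im_impedance, neg_div κ, neg_neg]
  exact div_nonneg (div_nonneg hre hκ.le) (Complex.normSq_nonneg _)

theorem le_norm_of_im_nonneg (hκ : 0 < κ) (hη : 0 < h / γ) (him : 0 ≤ (ζ x).im) :
    h / γ ≤ ‖((h / γ : ℝ) : ℂ) + ζ x / (Complex.I * κ)‖ ∧
      0 ≤ (nitscheLambda κ γ h ζ x).re := by
  have h1 : h / γ ≤ (((h / γ : ℝ) : ℂ) + ζ x / (Complex.I * κ)).re := by
    rw [Complex.add_re, Complex.ofReal_re, re_impedance]
    have : 0 ≤ (ζ x).im / κ := by positivity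
    linarith
  refine ⟨h1.trans (Complex.re_le_norm _), ?_⟩
  rw [nitscheLambda_eq, Complex.inv_re]
  exact div_nonneg (hη.le.trans h1) (Complex.normSq_nonneg _)

theorem le_norm_of_le_norm (hκ : 0 < κ) (hη : 0 < h / γ) (hδ : δ ≤ ‖ζ x‖)
    (hh : h / γ ≤ δ / (4 * κ)) :
    3 * δ / (4 * κ) ≤ ‖((h / γ : ℝ) : ℂ) + ζ x / (Complex.I * κ)‖ := by
  have h1 : ‖ζ x / (Complex.I * κ)‖ = ‖ζ x‖ / κ := by
    rw [norm_div, norm_mul, Complex.norm_I, one_mul, Complex.norm_of_nonneg hκ.le]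
  have h2 := norm_sub_le (((h / γ : ℝ) : ℂ) + ζ x / (Complex.I * κ)) ((h / γ : ℝ) : ℂ)
  rw [add_sub_cancel_left, h1, Complex.norm_of_nonneg hη.le] at h2
  have h3 : δ / κ ≤ ‖ζ x‖ / κ := by gcongr
  have h4 : δ / (4 * κ) = δ / κ / 4 := by rw [div_div, mul_comm]
  have h5 : 3 * δ / (4 * κ) = 3 * (δ / κ) / 4 := by field_simp
  linarith

theorem nitscheLambda_bounds_of_im_nonneg (hκ : 0 < κ) (hη : 0 < h / γ) (him : 0 ≤ (ζ x).im) :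
    ((h / γ : ℝ) : ℂ) + ζ x / (Complex.I * κ) ≠ 0 ∧
      ‖nitscheLambda κ γ h ζ x‖ ≤ (h / γ)⁻¹ ∧ h / γ * ‖nitscheLambda κ γ h ζ x‖ ≤ 1 := by
  have h1 := (le_norm_of_im_nonneg hκ hη him).1
  have h2 : ‖nitscheLambda κ γ h ζ x‖ ≤ (h / γ)⁻¹ := by
    rw [nitscheLambda_eq, norm_inv]
    exact inv_anti₀ hη h1
  refine ⟨norm_pos_iff.1 (hη.trans_le h1), h2, ?_⟩
  calc _ ≤ h / γ * (h / γ)⁻¹ := by gcongr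
    _ = 1 := mul_inv_cancel₀ hη.ne'

theorem nitscheLambda_bounds_of_le_norm (hκ : 0 < κ) (hδ0 : 0 < δ) (hη : 0 < h / γ)
    (hδ : δ ≤ ‖ζ x‖) (hh : h / γ ≤ δ / (4 * κ)) :
    ((h / γ : ℝ) : ℂ) + ζ x / (Complex.I * κ) ≠ 0 ∧
      ‖nitscheLambda κ γ h ζ x‖ ≤ 4 * κ / (3 * δ) ∧
      h / γ * ‖nitscheLambda κ γ h ζ x‖ ≤ 1 / 3 := by
  have h1 := le_norm_of_le_norm hκ hη hδ hh
  have h0 : 0 < 3 * δ / (4 * κ) := by positivity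
  have h2 : ‖nitscheLambda κ γ h ζ x‖ ≤ 4 * κ / (3 * δ) := by
    rw [nitscheLambda_eq, norm_inv, ← inv_div (3 * δ)]
    exact inv_anti₀ h0 h1
  refine ⟨norm_pos_iff.1 (h0.trans_le h1), h2, ?_⟩
  calc _ ≤ δ / (4 * κ) * (4 * κ / (3 * δ)) := by gcongr
    _ = 1 / 3 := by field_simp

end Pointwise

/-! ### From pointwise to almost everywhere on the interface. -/

theorem integral_sub_sub_add {μ : Measure R3} {f₁ f₂ f₃ f₄ : R3 → ℂ} (h₁ : Integrable f₁ μ)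
    (h₂ : Integrable f₂ μ) (h₃ : Integrable f₃ μ) (h₄ : Integrable f₄ μ) :
    ∫ x, (f₁ x - f₂ x - f₃ x + f₄ x) ∂μ =
      (∫ x, f₁ x ∂μ) - (∫ x, f₂ x ∂μ) - (∫ x, f₃ x ∂μ) + ∫ x, f₄ x ∂μ := by
  have h₁₂ : Integrable (fun x => f₁ x - f₂ x) μ := h₁.sub h₂
  have h₁₃ : Integrable (fun x => f₁ x - f₂ x - f₃ x) μ := h₁₂.sub h₃
  rw [integral_add h₁₃ h₄, integral_sub h₁₂ h₃, integral_sub h₁ h₂]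

namespace SplitDomain

variable (D : SplitDomain) {κ γ h δ : ℝ} {ζ : R3 → ℂ} {p : R3 → ℂ}

theorem nullMeasurableSet_im_neg (hζ : AEStronglyMeasurable ζ D.interfaceMeasure) :
    NullMeasurableSet {x | (ζ x).im < 0} D.interfaceMeasure :=
  nullMeasurableSet_lt (Complex.measurable_im.comp_aemeasurable hζ.aemeasurable)
    aemeasurable_const

theorem restrict_ΓIminus (hζ : AEStronglyMeasurable ζ D.interfaceMeasure) :
    surfaceMeasure.restrict (D.ΓIminus ζ) =
      D.interfaceMeasure.restrict {x | (ζ x).im < 0} := by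
  rw [Measure.restrict_restrict₀ (D.nullMeasurableSet_im_neg hζ), Set.inter_comm]
  rfl

/-- When Γ_I⁻ is null no bound on h is available, but then Im ζ < 0 almost nowhere on the interface.
-/
theorem ae_of_im_neg (hζ : AEStronglyMeasurable ζ D.interfaceMeasure)
    (hδ : ∀ᵐ x ∂(surfaceMeasure.restrict (D.ΓIminus ζ)), δ ≤ ‖ζ x‖)
    (hh : 0 < surfaceMeasure (D.ΓIminus ζ) → h ≤ γ * δ / (4 * κ)) (hγ : 0 < γ) :
    ∀ᵐ x ∂D.interfaceMeasure, (ζ x).im < 0 → δ ≤ ‖ζ x‖ ∧ h / γ ≤ δ / (4 * κ) := by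
  rw [D.restrict_ΓIminus hζ, ae_restrict_iff'₀ (D.nullMeasurableSet_im_neg hζ)] at hδ
  rcases (zero_le (a := surfaceMeasure (D.ΓIminus ζ))).eq_or_lt with h0 | h0
  · have hnull : ∀ᵐ x ∂surfaceMeasure, x ∉ D.ΓIminus ζ :=
      measure_eq_zero_iff_ae_notMem.1 h0.symm
    filter_upwards [ae_restrict_of_ae hnull, ae_restrict_mem D.measurableSet_ΓI]
      with x hx hxΓ him using absurd ⟨hxΓ, him⟩ hx
  · filter_upwards [hδ] with x hx him
    refine ⟨hx him, (div_le_iff₀ hγ).2 ((hh h0).trans_eq ?_)⟩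
    ring

/-- On the interface, `λ` is essentially bounded, has non-negative imaginary part, and the jump
controlled by `λ` is bounded by the terms of the form and, where `Im ζ < 0`, a multiple of the
jump. -/
theorem ae_nitscheLambda (hκ : 0 < κ) (hδ0 : 0 < δ) (hη : 0 < h / γ)
    (hre : ∀ᵐ x ∂D.interfaceMeasure, 0 ≤ (ζ x).re)
    (hneg : ∀ᵐ x ∂D.interfaceMeasure, (ζ x).im < 0 → δ ≤ ‖ζ x‖ ∧ h / γ ≤ δ / (4 * κ)) :
    ∀ᵐ x ∂D.interfaceMeasure,
      ((h / γ : ℝ) : ℂ) + ζ x / (Complex.I * κ) ≠ 0 ∧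
      ‖nitscheLambda κ γ h ζ x‖ ≤ max (h / γ)⁻¹ (4 * κ / (3 * δ)) ∧
      0 ≤ (nitscheLambda κ γ h ζ x).im ∧
      ∀ J F : ℂ, 1 / 4 * (‖nitscheLambda κ γ h ζ x‖ * ‖J‖ ^ 2) ≤
        2 / 3 * ((nitscheLambda κ γ h ζ x).re + (nitscheLambda κ γ h ζ x).im) *
          ‖J - (h / γ : ℝ) * F‖ ^ 2 + h / γ * ‖F‖ ^ 2 +
          {y | (ζ y).im < 0}.indicator (fun _ => 2 * κ / δ * ‖J‖ ^ 2) x := by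
  filter_upwards [hre, hneg] with x hrex hnegx
  have him := im_nitscheLambda_nonneg (γ := γ) (h := h) hκ hrex
  rcases lt_or_ge (ζ x).im 0 with hx | hx
  · obtain ⟨h1, h2, h3⟩ :=
      nitscheLambda_bounds_of_le_norm hκ hδ0 hη (hnegx hx).1 (hnegx hx).2
    refine ⟨h1, h2.trans (le_max_right _ _), him, fun J F => ?_⟩
    rw [Set.indicator_of_mem (show x ∈ {y | (ζ y).im < 0} from hx)]
    refine quarter_le_of_im_nonneg hη.le him h3 ?_
    -- The value 2κ/δ is exactly the weight of |J|² in 2κ‖Jp‖².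
    calc _ ≤ 3 / 2 * (4 * κ / (3 * δ)) := by gcongr
      _ = 2 * κ / δ := by field_simp; ring
  · obtain ⟨h1, h2, h3⟩ := nitscheLambda_bounds_of_im_nonneg hκ hη hx
    refine ⟨h1, h2.trans (le_max_left _ _), him, fun J F => ?_⟩
    rw [Set.indicator_of_notMem (show x ∉ {y | (ζ y).im < 0} from not_lt.2 hx), add_zero]
    exact quarter_le_of_nonneg hη.le (le_norm_of_im_nonneg hκ hη hx).2 him h3

theorem memLp_nitscheLambda {B : ℝ} (hζ : AEStronglyMeasurable ζ D.interfaceMeasure)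
    (hB : ∀ᵐ x ∂D.interfaceMeasure, ‖nitscheLambda κ γ h ζ x‖ ≤ B) :
    MemLp (nitscheLambda κ γ h ζ) ⊤ D.interfaceMeasure :=
  memLp_top_of_bound
    (((hζ.aemeasurable.div_const (Complex.I * κ)).const_add
      ((h : ℂ) / γ)).inv).aestronglyMeasurable B hB

theorem normSqU_mapJ (hκ : 0 < κ) (hδ : 0 < δ)
    (hζ : AEStronglyMeasurable ζ D.interfaceMeasure) :
    2 * κ * D.normSqU ζ (D.mapJ κ δ p) =
      2 * κ ^ 2 * (∫ x in D.Ω 0 ∪ D.Ω 1, ‖p x‖ ^ 2) +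
        ∫ x, {y | (ζ y).im < 0}.indicator (fun y => 2 * κ / δ * ‖D.jump p y‖ ^ 2) x
          ∂D.interfaceMeasure := by
  have h1 : ∀ x, ‖(Real.sqrt κ : ℂ) * p x‖ ^ 2 = κ * ‖p x‖ ^ 2 := fun x => by
    rw [norm_mul, mul_pow, Complex.norm_of_nonneg (Real.sqrt_nonneg _), Real.sq_sqrt hκ.le]
  have h2 : ∀ x, ‖D.jump p x / (Real.sqrt δ : ℂ)‖ ^ 2 = δ⁻¹ * ‖D.jump p x‖ ^ 2 := fun x => by
    rw [norm_div, div_pow, Complex.norm_of_nonneg (Real.sqrt_nonneg _), Real.sq_sqrt hδ.le,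
      div_eq_inv_mul]
  rw [integral_indicator₀ (D.nullMeasurableSet_im_neg hζ), ← D.restrict_ΓIminus hζ]
  simp only [normSqU, mapJ, h1, h2, integral_const_mul]
  ring

end SplitDomain

/-! ### The form at (p, conj p) and the final estimate. -/

namespace MeshPair

variable {D : SplitDomain} (M : MeshPair D) {k : ℕ} {p : R3 → ℂ}

/-- Only the sign of b is needed, so no integrability of traces on `Γio` has to be shown: the
identities used hold for Bochner integrals unconditionally. -/
theorem exists_formZero_conj_eq (hp : p ∈ M.feSpace k) (κ : ℝ) : ∃ b : ℝ, 0 ≤ b ∧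
    D.formZero κ p (fun x => (starRingEnd ℂ) (p x)) =
      (((∫ x in D.Ω 0 ∪ D.Ω 1, gradSq p x) - κ ^ 2 * (∫ x in D.Ω 0 ∪ D.Ω 1, ‖p x‖ ^ 2) : ℝ) : ℂ)
        + Complex.I * κ * b := by
  refine ⟨∑ i, ∫ x in D.Γio ∩ frontier (D.Ω i), ‖D.trace i p x‖ ^ 2 ∂surfaceMeasure,
    Finset.sum_nonneg fun i _ => integral_nonneg fun x => by positivity, ?_⟩
  have h1 : ∀ i, ∫ x in D.Γio ∩ frontier (D.Ω i), D.trace i p x *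
      D.trace i (fun x => (starRingEnd ℂ) (p x)) x ∂surfaceMeasure =
      ((∫ x in D.Γio ∩ frontier (D.Ω i), ‖D.trace i p x‖ ^ 2 ∂surfaceMeasure : ℝ) : ℂ) := by
    intro i
    rw [← integral_complex_ofReal]
    refine integral_congr_ae ?_
    filter_upwards [ae_restrict_mem (D.measurableSet_Γio.inter isClosed_frontier.measurableSet),
      M.ae_notMem_edges i _] with x hx he
    rw [M.trace_conj hp hx.2 he, Complex.mul_conj']
    push_cast; rfl
  have h2 : ∫ x in D.Ω 0 ∪ D.Ω 1, p x * (starRingEnd ℂ) (p x) =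
      ((∫ x in D.Ω 0 ∪ D.Ω 1, ‖p x‖ ^ 2 : ℝ) : ℂ) := by
    rw [← integral_complex_ofReal]
    simp only [Complex.mul_conj']
    push_cast; rfl
  have h3 : ∫ x in D.Ω 0 ∪ D.Ω 1, gradDot p (fun x => (starRingEnd ℂ) (p x)) x =
      ((∫ x in D.Ω 0 ∪ D.Ω 1, gradSq p x : ℝ) : ℂ) := by
    rw [← integral_complex_ofReal]
    simp only [gradDot_conj]
  simp only [SplitDomain.formZero, h1, h2, h3]
  push_cast; rfl

/-- All factors are essentially bounded on a finite measure space, so the four interface integrals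
merge into one, to which the pointwise identity applies. -/
theorem formLambda_conj_eq (hp : p ∈ M.feSpace k) {κ γ h : ℝ} {ζ : R3 → ℂ}
    (hζ : MemLp ζ ⊤ D.interfaceMeasure)
    (hlam : MemLp (nitscheLambda κ γ h ζ) ⊤ D.interfaceMeasure)
    (hne : ∀ᵐ x ∂D.interfaceMeasure, ((h / γ : ℝ) : ℂ) + ζ x / (Complex.I * κ) ≠ 0) :
    D.formLambda κ ζ (nitscheLambda κ γ h ζ) p (fun x => (starRingEnd ℂ) (p x)) =
      D.formZero κ p (fun x => (starRingEnd ℂ) (p x)) +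
      ∫ x, (nitscheLambda κ γ h ζ x *
        ((‖D.jump p x - (h / γ : ℝ) * D.avgFlux p x‖ ^ 2 : ℝ) : ℂ)
        - ((h / γ * ‖D.avgFlux p x‖ ^ 2 : ℝ) : ℂ)) ∂D.interfaceMeasure := by
  have := M.isFiniteMeasure_interfaceMeasure
  have hF := M.memLp_avgFlux hp
  have hJ := M.memLp_jump hp
  have hFc : MemLp (D.avgFlux fun x => (starRingEnd ℂ) (p x)) ⊤ D.interfaceMeasure :=
    hF.star.ae_eq (by filter_upwards [M.ae_avgFlux_conj hp] with x hx using hx.symm)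
  have hJc : MemLp (D.jump fun x => (starRingEnd ℂ) (p x)) ⊤ D.interfaceMeasure :=
    hJ.star.ae_eq (by filter_upwards [M.ae_jump_conj hp] with x hx using hx.symm)
  have hz : MemLp (fun x => ζ x / (Complex.I * κ)) ⊤ D.interfaceMeasure := by
    simp only [div_eq_mul_inv]
    exact hζ.mul_const _
  have hmul : ∀ {f g : R3 → ℂ}, MemLp f ⊤ D.interfaceMeasure → MemLp g ⊤ D.interfaceMeasure →
      MemLp (fun x => f x * g x) ⊤ D.interfaceMeasure := fun hf hg => hg.mul hf
  have hR : MemLp (D.residual κ ζ p) ⊤ D.interfaceMeasure := hJ.add (hmul hz hF)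
  have hRc : MemLp (D.residual κ ζ fun x => (starRingEnd ℂ) (p x)) ⊤ D.interfaceMeasure :=
    hJc.add (hmul hz hFc)
  have i1 := (hmul hF hRc).integrable le_top
  have i2 := (hmul hR hFc).integrable le_top
  have i3 := (hmul (hmul hz hF) hFc).integrable le_top
  have i4 := (hmul (hmul hlam hR) hRc).integrable le_top
  have hsum := integral_sub_sub_add i3 i1 i2 i4
  have hcongr : ∫ x, (nitscheLambda κ γ h ζ x *
        ((‖D.jump p x - (h / γ : ℝ) * D.avgFlux p x‖ ^ 2 : ℝ) : ℂ)
        - ((h / γ * ‖D.avgFlux p x‖ ^ 2 : ℝ) : ℂ)) ∂D.interfaceMeasure =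
      _ := (integral_congr_ae (by
    filter_upwards [M.ae_avgFlux_conj hp, M.ae_jump_conj hp, hne] with x h1 h2 h3
    rw [nitscheLambda_eq, ← nitsche_interface_identity rfl h3]
    simp only [SplitDomain.residual, h1, h2])).trans hsum
  rw [hcongr, SplitDomain.formLambda]
  ring

theorem quarter_tripleNormSq_le (hp : p ∈ M.feSpace k) {C κ γ δ : ℝ} {ζ : R3 → ℂ}
    (hC0 : 0 < C) (hC : M.InverseInequality k C) (hκ : 0 < κ) (hδ0 : 0 < δ)
    (hζ : MemLp ζ ⊤ D.interfaceMeasure) (hre : ∀ᵐ x ∂D.interfaceMeasure, 0 ≤ (ζ x).re)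
    (hδ : ∀ᵐ x ∂(surfaceMeasure.restrict (D.ΓIminus ζ)), δ ≤ ‖ζ x‖)
    (hh : 0 < surfaceMeasure (D.ΓIminus ζ) → M.meshSize ≤ γ * δ / (4 * κ))
    (hγC : 16 * C ≤ γ) :
    1 / 4 * D.tripleNormSq κ γ M.meshSize (nitscheLambda κ γ M.meshSize ζ) p ≤
      ‖D.formLambda κ ζ (nitscheLambda κ γ M.meshSize ζ) p
        (fun x => (starRingEnd ℂ) (p x))‖ + 2 * κ * D.normSqU ζ (D.mapJ κ δ p) := by
  have := M.isFiniteMeasure_interfaceMeasure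
  have hγ : 0 < γ := by linarith
  have hη : 0 < M.meshSize / γ := div_pos M.meshSize_pos hγ
  have hpt := D.ae_nitscheLambda hκ hδ0 hη hre (D.ae_of_im_neg hζ.1 hδ hh hγ)
  have hlam : MemLp (nitscheLambda κ γ M.meshSize ζ) ⊤ D.interfaceMeasure :=
    D.memLp_nitscheLambda hζ.1 (hpt.mono fun x hx => hx.2.1)
  have hF := M.memLp_avgFlux hp
  have hJ := M.memLp_jump hp
  set η := M.meshSize / γ with hη_def
  set lam := nitscheLambda κ γ M.meshSize ζ with hlam_def
  set F := D.avgFlux p with hF_def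
  set J := D.jump p with hJ_def
  obtain ⟨b, hb0, hb⟩ := M.exists_formZero_conj_eq hp κ
  have hform := M.formLambda_conj_eq hp hζ hlam (hpt.mono fun x hx => hx.1)
  rw [hb] at hform
  -- integrability of the terms on the interface
  have hmul : ∀ {f g : R3 → ℂ}, MemLp f ⊤ D.interfaceMeasure → MemLp g ⊤ D.interfaceMeasure →
      MemLp (fun x => f x * g x) ⊤ D.interfaceMeasure := fun hf hg => hg.mul hf
  have hsq : ∀ {f : R3 → ℂ}, MemLp f ⊤ D.interfaceMeasure →
      MemLp (fun x => ‖f x‖ ^ 2) ⊤ D.interfaceMeasure := fun hf => by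
    simp only [sq]
    exact hf.norm.mul hf.norm
  have hX := hsq (hJ.sub (hF.const_mul ((η : ℝ) : ℂ)))
  have iX : Integrable (fun x => lam x * ((‖J x - (η : ℝ) * F x‖ ^ 2 : ℝ) : ℂ))
      D.interfaceMeasure := (hmul hlam hX.ofReal).integrable le_top
  have iF : Integrable (fun x => η * ‖F x‖ ^ 2) D.interfaceMeasure :=
    ((hsq hF).integrable le_top).const_mul η
  have iJ : Integrable (fun x => {y | (ζ y).im < 0}.indicator
      (fun y => 2 * κ / δ * ‖J y‖ ^ 2) x) D.interfaceMeasure :=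
    (((hsq hJ).integrable le_top).const_mul _).indicator₀ (D.nullMeasurableSet_im_neg hζ.1)
  have iL : Integrable (fun x => ‖lam x‖ * ‖J x‖ ^ 2) D.interfaceMeasure :=
    ((hsq hJ).mul (p := ⊤) hlam.norm).integrable le_top
  set S : ℂ := ∫ x, (lam x * ((‖J x - (η : ℝ) * F x‖ ^ 2 : ℝ) : ℂ)
    - ((η * ‖F x‖ ^ 2 : ℝ) : ℂ)) ∂D.interfaceMeasure with hS
  have hSeq : S = (∫ x, lam x * ((‖J x - (η : ℝ) * F x‖ ^ 2 : ℝ) : ℂ) ∂D.interfaceMeasure)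
      - ((∫ x, η * ‖F x‖ ^ 2 ∂D.interfaceMeasure : ℝ) : ℂ) := by
    have iF' : Integrable (fun x => ((η * ‖F x‖ ^ 2 : ℝ) : ℂ)) D.interfaceMeasure := iF.ofReal
    rw [hS, integral_sub iX iF', integral_complex_ofReal]
  have hreS : (∫ x, lam x * ((‖J x - (η : ℝ) * F x‖ ^ 2 : ℝ) : ℂ) ∂D.interfaceMeasure).re =
      ∫ x, (lam x).re * ‖J x - (η : ℝ) * F x‖ ^ 2 ∂D.interfaceMeasure := by
    rw [← Complex.reCLM_apply, ← Complex.reCLM.integral_comp_comm iX]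
    simp only [Complex.reCLM_apply, Complex.re_mul_ofReal]
  have himS : (∫ x, lam x * ((‖J x - (η : ℝ) * F x‖ ^ 2 : ℝ) : ℂ) ∂D.interfaceMeasure).im =
      ∫ x, (lam x).im * ‖J x - (η : ℝ) * F x‖ ^ 2 ∂D.interfaceMeasure := by
    rw [← Complex.imCLM_apply, ← Complex.imCLM.integral_comp_comm iX]
    simp only [Complex.imCLM_apply, Complex.im_mul_ofReal]
  have iRe : Integrable (fun x => (lam x).re * ‖J x - (η : ℝ) * F x‖ ^ 2) D.interfaceMeasure := by
    have := Complex.reCLM.integrable_comp iX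
    simpa only [Complex.reCLM_apply, Complex.re_mul_ofReal] using this
  have iIm : Integrable (fun x => (lam x).im * ‖J x - (η : ℝ) * F x‖ ^ 2) D.interfaceMeasure := by
    have := Complex.imCLM.integrable_comp iX
    simpa only [Complex.imCLM_apply, Complex.im_mul_ofReal] using this
  have hmain : 1 / 4 * ∫ x, ‖lam x‖ * ‖J x‖ ^ 2 ∂D.interfaceMeasure ≤
      2 / 3 * ((∫ x, (lam x).re * ‖J x - (η : ℝ) * F x‖ ^ 2 ∂D.interfaceMeasure) +
        ∫ x, (lam x).im * ‖J x - (η : ℝ) * F x‖ ^ 2 ∂D.interfaceMeasure) +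
      (∫ x, η * ‖F x‖ ^ 2 ∂D.interfaceMeasure) +
      ∫ x, {y | (ζ y).im < 0}.indicator (fun y => 2 * κ / δ * ‖J y‖ ^ 2) x
        ∂D.interfaceMeasure := by
    have i1 : Integrable (fun x => 2 / 3 * ((lam x).re * ‖J x - (η : ℝ) * F x‖ ^ 2 +
        (lam x).im * ‖J x - (η : ℝ) * F x‖ ^ 2)) D.interfaceMeasure := (iRe.add iIm).const_mul _
    have i2 : Integrable (fun x => 2 / 3 * ((lam x).re * ‖J x - (η : ℝ) * F x‖ ^ 2 +
        (lam x).im * ‖J x - (η : ℝ) * F x‖ ^ 2) + η * ‖F x‖ ^ 2) D.interfaceMeasure := i1.add iF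
    rw [← integral_add iRe iIm, ← integral_const_mul, ← integral_const_mul,
      ← integral_add i1 iF, ← integral_add i2 iJ]
    refine integral_mono_ae (iL.const_mul _) (i2.add iJ) ?_
    filter_upwards [hpt] with x hx
    have h1 := hx.2.2.2 (J x) (F x)
    have h2 : {y | (ζ y).im < 0}.indicator (fun y => 2 * κ / δ * ‖J y‖ ^ 2) x =
        {y | (ζ y).im < 0}.indicator (fun _ => 2 * κ / δ * ‖J x‖ ^ 2) x := by
      by_cases hx : x ∈ {y | (ζ y).im < 0} <;> simp [hx]
    refine h1.trans_eq ?_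
    simp only [h2]
    ring
  -- the inverse inequality
  have hinv : 16 * ∫ x, η * ‖F x‖ ^ 2 ∂D.interfaceMeasure ≤
      ∫ x in D.Ω 0 ∪ D.Ω 1, gradSq p x := by
    have h1 := hC p hp
    have hG : 0 ≤ ∫ x in D.Ω 0 ∪ D.Ω 1, gradSq p x :=
      integral_nonneg fun x => gradSq_nonneg p x
    have h2 : ∫ x, η * ‖F x‖ ^ 2 ∂D.interfaceMeasure =
        γ⁻¹ * ∫ x, M.meshSize * ‖F x‖ ^ 2 ∂D.interfaceMeasure := by
      rw [← integral_const_mul]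
      congr 1 with x
      rw [hη_def]; ring
    rw [h2]
    calc _ ≤ 16 * (γ⁻¹ * (C * ∫ x in D.Ω 0 ∪ D.Ω 1, gradSq p x)) := by gcongr
      _ = γ⁻¹ * (16 * C * ∫ x in D.Ω 0 ∪ D.Ω 1, gradSq p x) := by ring
      _ ≤ γ⁻¹ * (γ * ∫ x in D.Ω 0 ∪ D.Ω 1, gradSq p x) := by gcongr
      _ = _ := inv_mul_cancel_left₀ hγ.ne' _
  have hflux : 1 / γ * ∫ x, M.meshSize * ‖F x‖ ^ 2 ∂D.interfaceMeasure =
      ∫ x, η * ‖F x‖ ^ 2 ∂D.interfaceMeasure := by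
    rw [← integral_const_mul]
    congr 1 with x
    rw [hη_def]; ring
  have hnorm := two_thirds_mul_re_add_im_le_norm
    (D.formLambda κ ζ lam p (fun x => (starRingEnd ℂ) (p x)))
  have hN : 0 ≤ κ ^ 2 * ∫ x in D.Ω 0 ∪ D.Ω 1, ‖p x‖ ^ 2 :=
    mul_nonneg (sq_nonneg κ) (integral_nonneg fun x => by positivity)
  have hF0 : 0 ≤ ∫ x, η * ‖F x‖ ^ 2 ∂D.interfaceMeasure :=
    integral_nonneg fun x => by positivity
  have hκb : 0 ≤ κ * b := by positivity
  rw [D.normSqU_mapJ hκ hδ0 hζ.1, SplitDomain.tripleNormSq]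
  change 1 / 4 * (_ + _ + 1 / γ * (∫ x, M.meshSize * ‖F x‖ ^ 2 ∂D.interfaceMeasure) +
    ∫ x, ‖lam x‖ * ‖J x‖ ^ 2 ∂D.interfaceMeasure) ≤ _
  rw [hflux]
  have hreA := congrArg Complex.re hform
  have himA := congrArg Complex.im hform
  rw [Complex.add_re, hSeq, Complex.sub_re, hreS] at hreA
  rw [Complex.add_im, hSeq, Complex.sub_im, himS] at himA
  simp only [Complex.add_re, Complex.add_im, Complex.ofReal_re, Complex.ofReal_im, Complex.mul_re,
    Complex.mul_im, Complex.I_re, Complex.I_im, zero_mul, mul_zero, one_mul, sub_zero, zero_add,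
    add_zero] at hreA himA
  rw [hreA, himA] at hnorm
  -- With G the gradient integral and Φ = ∫η|F|², what is left to check is (2/3 − 1/4)G ≥ (2/3 + 1 +
  -- 1/4)Φ, which 16Φ ≤ G amply covers. The coefficient of κ²∫|p|² is 2 − 2/3 ≥ 1/4, and κb ≥ 0 is
  -- dropped.
  linarith

end MeshPair

end

theorem theorem2 (k : ℕ) (hk : 1 ≤ k) (σ τ : ℝ) :
    ∃ C₀ : ℝ, 0 < C₀ ∧
      ∀ (D : SplitDomain) (M : MeshPair D), M.NonDegenerate σ → M.QuasiUniform τ →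
        M.InverseInequality k C₀ ∧
        ∀ C_I : ℝ, 0 < C_I → M.InverseInequality k C_I →
        ∀ (κ γ δ : ℝ) (ζ : R3 → ℂ), 0 < κ → 0 < δ →
          MemLp ζ ⊤ (surfaceMeasure.restrict D.ΓI) →
          (∀ᵐ x ∂(surfaceMeasure.restrict D.ΓI), 0 ≤ (ζ x).re) →
          (∀ᵐ x ∂(surfaceMeasure.restrict (D.ΓIminus ζ)), δ ≤ ‖ζ x‖) →
          (0 < surfaceMeasure (D.ΓIminus ζ) → M.meshSize ≤ γ * δ / (4 * κ)) →
          16 * C_I ≤ γ →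
          ∀ p ∈ M.feSpace k,
            1 / 4 * D.tripleNormSq κ γ M.meshSize (nitscheLambda κ γ M.meshSize ζ) p ≤
              ‖D.formLambda κ ζ (nitscheLambda κ γ M.meshSize ζ) p
                (fun x => (starRingEnd ℂ) (p x))‖
              + 2 * κ * D.normSqU ζ (D.mapJ κ δ p) := by
  obtain ⟨C₀, hC₀, hinv⟩ := exists_inverseInequality k σ τ
  refine ⟨C₀, hC₀, fun D M hσ hτ => ⟨hinv D M hσ hτ, ?_⟩⟩
  intro C_I hC hCI κ γ δ ζ hκ hδ0 hζ hre hδ hh hγ p hp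
  exact M.quarter_tripleNormSq_le hp hC hCI hκ hδ0 hζ hre hδ hh hγ
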